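/- **Setting.** Let $N\in\mathbb N$, $0<d<N$, and let $G$ be the Erdős–Rényi graph on $[N]=\{1,\dots,N\}$ with edge probability $d/N$ and adjacency matrix $A$. For a graph $H$ on $[N]$ let $B^H_r(x)$ be the ball of real radius $r$ around $x$ in the graph distance of $H$ (empty if $r<0$), and let $\mathrm{Adj}(H)$ be its adjacency matrix. Write $D_x$ for the degree of $x$ in $G$, $\alpha_x=D_x/d$, $\mathcal V_\tau=\{x: D_x\ge\tau d\}$, $\mathbf 1_x$ for the standard basis vectors of $\mathbb R^N$, $a\wedge b=\min\{a,b\}$, $a\vee b=\max\{a,b\}$, and $$\Lambda(t)=\frac{t}{\sqrt{t-1}}\ (t\ge2),\qquad \alpha(\eta)=\frac{\eta}{2}\bigl(\eta+\sqrt{\eta^2-4}\bigr)\ (\eta\ge 2),\qquad h(a)=(1+a)\log(1+a)-a\ (a\ge 0).$$ **Pruned graph.** Put $$r_x=\Bigl\lfloor\frac{\log N}{3\log D_x}\Bigr\rfloor,\qquad r(\tau)=\frac{d}{2\log d}\,h\Bigl(\frac{\tau-1}{2}\Bigr)-2,\qquad r_{x,\tau}=\frac{r_x}{4}\wedge\frac{r(\tau)}{2}.$$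 For $x\in\mathcal V_\tau$ and a neighbour $y$ of $x$, let $T_y=T_y(x)$ be the set of vertices connected to $y$ by a path in $G$ of length at most $r_x$ that does not traverse the edge $\{x,y\}$. Let $H^{(1)}$ consist of all edges $\{x,y\}$ of $G$ with $x\in\mathcal V_\tau$ such that $G|_{T_y}$ is not a tree or $x\in T_y$. Let $H^{(2)}$ consist of all edges incident to some $x\in\mathcal V_\tau$ that are traversed by a path in $G\setminus H^{(1)}$ of length at most $2r_{x,\tau}$ from $x$ to another vertex of $\mathcal V_\tau$. Set $G_\tau=G\setminus(H^{(1)}\cup H^{(2)})$. **Matrices.** Let $\mathcal Z_\tau=\bigcup_{x\in\mathcal V_\tau}B^{G_\tau}_{r_{x,\tau}-2}(x)$, let $\Pi_\tau$ be the orthogonal projection onto $\mathrm{Span}\{\mathbf 1_y: y\notin\mathcal Z_\tau\}$, and set $\underline A_\tau=\mathrm{Adj}(G_\tau)-\Pi_\tau(\mathbb EA)\Pi_\tau$. Let $\sigma$ be a permutation of $[N]$ with $\alpha_{\sigma(1)}\ge\dots\ge\alpha_{\sigma(N)}$. For $\kappa\in(0,1/2)$ let $L_\le=\max\{l\ge1:\alpha_{\sigma(l)}\ge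 2+(\log d)^{-\kappa}\}$, with $L_\le=0$ if there is no such $l$. Let $V_l=[N]\setminus\{\sigma(1),\dots,\sigma(l-1)\}$ and let $\underline A_{\tau,l}$ be the $N\times N$ matrix with entries $(\underline A_\tau)_{xy}\mathbf 1_{x\in V_l}\mathbf 1_{y\in V_l}$. Finally, for $\mu,\zeta>0$ let $$\mathcal W_{\tau,\mu,\zeta}=\{x\in[N]:\ \alpha_x\ge\tau,\ \mu\ge\sqrt d\,(\Lambda(\alpha_x\vee2)+\zeta)\}.$$ **Proposition 7.2 (Delocalization estimate).** There is a universal constant $c>0$ such that for every $\nu>0$ there are constants $\mathcal K\ge1$ and $\mathcal C>0$, depending only on $\nu$, with the following property. Let $\kappa\in(0,1/2)$, $\theta\in(0,1/2]$, $(\log N)^{4/(5-2\theta)}\le d\le\mathcal K^{-1}N^{1/4}$ and $1+d^{-\theta/4}\le\tau\le2$. Then, with probability at least $1-\mathcal C N^{-\nu}$, the following holds for every $\sigma$ as above and every $l\in\{1,\dots,L_\le\}$. If an eigenvalue $\mu>2\sqrt d$ of $\underline A_{\tau,l}$ and some $\zeta>0$ satisfy $$\zeta\ \ge\ \biggl(\mathcal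 C\Bigl(\frac{\mu}{\mu-2\sqrt d}\Bigr)^{1/2}d^{-\theta/2}\biggr)\vee d^{-c(\mu/\sqrt d-2)}\qquad\text{and}\qquad \mu\ge\sqrt d\,(2+\zeta),$$ then every normalized eigenvector $\mathbf w$ of $\underline A_{\tau,l}$ associated with $\mu$ satisfies $$\alpha\Bigl(\frac{\mu}{\sqrt d}\Bigr)\sum_{x\in\mathcal W_{\tau,\mu,\zeta}}\langle\mathbf w,\mathbf 1_x\rangle^2\ \le\ \mathcal C\,d^{-c\left((\mu/\sqrt d-2)\wedge\log(\mu/\sqrt d)\right)}.$$ -/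

import Mathlib

open MeasureTheory SimpleGraph

noncomputable section

namespace ERGraph

/-! ### Deterministic functions -/

/-- `h(a) = (1 + a) log (1 + a) - a`, for `a ≥ 0`. -/
def bennett (a : ℝ) : ℝ := (1 + a) * Real.log (1 + a) - a

/-- `Λ(t) = t / √(t - 1)`, for `t ≥ 2`. -/
def Lam (t : ℝ) : ℝ := t / Real.sqrt (t - 1)

/-- `α(η) = (η / 2) (η + √(η² - 4))`, for `η ≥ 2`; the inverse function of `Λ`. -/
def alphaFun (η : ℝ) : ℝ := η / 2 * (η + Real.sqrt (η ^ 2 - 4))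

/-- `r(τ) = d / (2 log d) * h((τ - 1) / 2) - 2`. -/
def rTau (d τ : ℝ) : ℝ := d / (2 * Real.log d) * bennett ((τ - 1) / 2) - 2

variable {N : ℕ}

/-! ### Degrees -/

open scoped Classical in
/-- The adjacency matrix of a graph on `N` vertices. -/
def adj (G : SimpleGraph (Fin N)) : Matrix (Fin N) (Fin N) ℝ := G.adjMatrix ℝ

open scoped Classical in
/-- The degree `D_x` of the vertex `x`. -/
def deg (G : SimpleGraph (Fin N)) (x : Fin N) : ℕ := G.degree x

/-- The normalized degree `α_x = D_x / d`. -/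
def normDeg (d : ℝ) (G : SimpleGraph (Fin N)) (x : Fin N) : ℝ := (deg G x : ℝ) / d

/-- `𝒱_τ = {x : D_x ≥ τ d}`. -/
def largeDeg (d τ : ℝ) (G : SimpleGraph (Fin N)) : Set (Fin N) := {x | τ * d ≤ (deg G x : ℝ)}

/-! ### The pruned graph -/

/-- `r_x = ⌊log N / (3 log D_x)⌋`. -/
def rStar (G : SimpleGraph (Fin N)) (x : Fin N) : ℕ :=
  ⌊Real.log (N : ℝ) / (3 * Real.log (deg G x : ℝ))⌋₊

/-- `r_{x,τ} = (r_x / 4) ∧ (r(τ) / 2)`. -/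
def rVert (d τ : ℝ) (G : SimpleGraph (Fin N)) (x : Fin N) : ℝ :=
  min ((rStar G x : ℝ) / 4) (rTau d τ / 2)

/-- `T_y` (for the neighbour `y` of `x`): the vertices connected to `y` by a path in `G` of length at
most `r_x` that does not traverse the edge between `x` and `y`. -/
def branch (G : SimpleGraph (Fin N)) (x y : Fin N) : Set (Fin N) :=
  {z | ∃ p : G.Walk y z, p.IsPath ∧ p.length ≤ rStar G x ∧ s(x, y) ∉ p.edges}

/-- The edges of `H⁽¹⁾`: the edges `{x, y}` with `x ∈ 𝒱_τ` such that the subgraph induced by `G` on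
`T_y` is not a tree, or `x ∈ T_y`. -/
def cutOne (d τ : ℝ) (G : SimpleGraph (Fin N)) : Set (Sym2 (Fin N)) :=
  {e | ∃ x ∈ largeDeg d τ G, ∃ y, G.Adj x y ∧ e = s(x, y) ∧
    (¬ (G.induce (branch G x y)).IsTree ∨ x ∈ branch G x y)}

/-- The edges of `H⁽²⁾`: the edges incident to some `x ∈ 𝒱_τ` that are traversed by a path in
`G ∖ H⁽¹⁾` of length at most `2 r_{x,τ}` connecting `x` to another vertex of `𝒱_τ`. -/
def cutTwo (d τ : ℝ) (G : SimpleGraph (Fin N)) : Set (Sym2 (Fin N)) :=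
  {e | ∃ x ∈ largeDeg d τ G, ∃ y ∈ largeDeg d τ G, y ≠ x ∧
    ∃ p : (G.deleteEdges (cutOne d τ G)).Walk x y,
      p.IsPath ∧ (p.length : ℝ) ≤ 2 * rVert d τ G x ∧ e ∈ p.edges ∧ x ∈ e}

/-- The pruned graph `G_τ = G ∖ (H⁽¹⁾ ∪ H⁽²⁾)`. -/
def pruned (d τ : ℝ) (G : SimpleGraph (Fin N)) : SimpleGraph (Fin N) :=
  G.deleteEdges (cutOne d τ G ∪ cutTwo d τ G)

/-! ### The pruned, restricted, centred matrix -/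

/-- The ball `{y : dist(x, y) ≤ r}` in the graph `H`, for a real radius `r` (empty if `r < 0`). -/
def gball (H : SimpleGraph (Fin N)) (x : Fin N) (r : ℝ) : Set (Fin N) :=
  {y | H.Reachable x y ∧ (H.dist x y : ℝ) ≤ r}

/-- `𝒵_τ`, the union over `x ∈ 𝒱_τ` of the balls of radius `r_{x,τ} - 2` around `x` in `G_τ`. -/
def zSet (d τ : ℝ) (G : SimpleGraph (Fin N)) : Set (Fin N) :=
  {y | ∃ x ∈ largeDeg d τ G, y ∈ gball (pruned d τ G) x (rVert d τ G x - 2)}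

/-- The expectation `𝔼 A` of the adjacency matrix (entrywise, with respect to the law `P` of the
random graph). -/
def expAdj (P : Measure (SimpleGraph (Fin N))) : Matrix (Fin N) (Fin N) ℝ :=
  Matrix.of fun x y => ∫ G, adj G x y ∂P

open scoped Classical in
/-- `Π_τ`, the orthogonal projection onto `Span {1_y : y ∉ 𝒵_τ}`. -/
def projZ (d τ : ℝ) (G : SimpleGraph (Fin N)) : Matrix (Fin N) (Fin N) ℝ :=
  Matrix.diagonal fun y => if y ∈ zSet d τ G then 0 else 1

/-- `A̲_τ = Adj(G_τ) - Π_τ (𝔼 A) Π_τ`. -/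
def centredPruned (P : Measure (SimpleGraph (Fin N))) (d τ : ℝ) (G : SimpleGraph (Fin N)) :
    Matrix (Fin N) (Fin N) ℝ :=
  adj (pruned d τ G) - projZ d τ G * expAdj P * projZ d τ G

/-- `σ` lists the vertices in order of nonincreasing degree (`σ 0` is the first vertex). -/
def IsDegreeOrdering (d : ℝ) (G : SimpleGraph (Fin N)) (σ : Equiv.Perm (Fin N)) : Prop :=
  Antitone fun k => normDeg d G (σ k)

/-- `L_≤ = max {l ≥ 1 : α_{σ(l)} ≥ 2 + (log d)^{-κ}}`, and `0` if there is no such `l`. The `l`-th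
vertex in the ordering is `σ k` with `l = k + 1`. -/
def lastLarge (d κ : ℝ) (G : SimpleGraph (Fin N)) (σ : Equiv.Perm (Fin N)) : ℕ :=
  sSup {l : ℕ | ∃ k : Fin N, l = (k : ℕ) + 1 ∧ 2 + Real.log d ^ (-κ) ≤ normDeg d G (σ k)}

/-- `V_l`: all vertices except the first `l - 1` vertices in the ordering `σ`. -/
def vSet (σ : Equiv.Perm (Fin N)) (l : ℕ) : Set (Fin N) :=
  {x | ∀ k : Fin N, (k : ℕ) + 1 < l → x ≠ σ k}

open scoped Classical in
/-- `A̲_{τ,l}`, with entries `(A̲_τ)_{xy} 1(x ∈ V_l) 1(y ∈ V_l)`. -/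
def restrictedMatrix (P : Measure (SimpleGraph (Fin N))) (d τ : ℝ) (G : SimpleGraph (Fin N))
    (σ : Equiv.Perm (Fin N)) (l : ℕ) : Matrix (Fin N) (Fin N) ℝ :=
  Matrix.of fun x y =>
    if x ∈ vSet σ l ∧ y ∈ vSet σ l then centredPruned P d τ G x y else 0

open scoped Classical in
/-- `𝒲_{τ,μ,ζ} = {x : α_x ≥ τ, μ ≥ √d (Λ(α_x ∨ 2) + ζ)}`. -/
def wSet (d τ μ ζ : ℝ) (G : SimpleGraph (Fin N)) : Finset (Fin N) :=
  {x | τ ≤ normDeg d G x ∧ Real.sqrt d * (Lam (max (normDeg d G x) 2) + ζ) ≤ μ}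

/-- The delocalization estimate for a given realization `G` of the random graph: for each ordering
of the vertices by degree, each `l ∈ [L_≤]`, each eigenvalue `μ > 2√d` of `A̲_{τ,l}` with normalized
eigenvector `w`, and each `ζ` that satisfies the two lower-bound conditions. -/
def DelocalizationEstimate (P : Measure (SimpleGraph (Fin N))) (c C d θ τ κ : ℝ)
    (G : SimpleGraph (Fin N)) : Prop :=
  ∀ σ : Equiv.Perm (Fin N), IsDegreeOrdering d G σ →
  ∀ l : ℕ, 1 ≤ l → l ≤ lastLarge d κ G σ →
  ∀ μ ζ : ℝ, 2 * Real.sqrt d < μ → 0 < ζ →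
    max (C * (μ / (μ - 2 * Real.sqrt d)) ^ (1 / 2 : ℝ) * d ^ (-θ / 2))
      (d ^ (-c * (μ / Real.sqrt d - 2))) ≤ ζ →
    Real.sqrt d * (2 + ζ) ≤ μ →
  ∀ w : EuclideanSpace ℝ (Fin N), ‖w‖ = 1 →
    Module.End.HasEigenvector (Matrix.toEuclideanLin (restrictedMatrix P d τ G σ l)) μ w →
    alphaFun (μ / Real.sqrt d) * ∑ x ∈ wSet d τ μ ζ G, w x ^ 2 ≤
      C * d ^ (-c * min (μ / Real.sqrt d - 2) (Real.log (μ / Real.sqrt d)))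

end ERGraph

end

/-! Put $t=\mu/\sqrt d$. Around $x\in\mathcal V_\tau$ the pruned graph is a tree without other
vertices of $\mathcal V_\tau$, the vertices deleted by passing to $V_l$ are far away (unless $x$
itself is deleted, when $w_x=0$), and the projection removes the centring term. So near $x$ an
eigenvector solves $\mu w_y=\sum_{z\sim y}w_z$. Remove $x$. Let $M$ be the adjacency matrix of the
punctured ball and $b$ the indicator of the neighbours of $x$. Then $\mu w=Mw+w_xb$ and $\langle
b,w\rangle=\mu w_x$; iterating $n$ times gives $w_x\bigl(\mu-\sum_{j<n}\mu^{-j-1}\langle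
M^jb,b\rangle\bigr)=\mu^{-n}\langle M^nb,w\rangle$. A supersolution $f_2$ bounds the Neumann sum by
$\langle b,f_2\rangle\le\mu-\sqrt d\,\zeta/2$, which is where $\mu\ge\sqrt
d(\Lambda(\alpha_x\vee2)+\zeta)$ enters. A second one and the Schur test bound $\|M\|$ by $\sqrt
d\sqrt{2t}$. Hence $w_x^2\le(2/t)^n\,4\alpha_x\zeta^{-2}$ times the mass of $w$ in a ball
(`localization_bound`, `vertex_bound`). The balls are disjoint, so one may sum over $x$, and
$n\ge12\log d$ absorbs all other factors (`decay_bound`). The supersolutions are products of weights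
along the tree (`exists_supersolution`). Degrees in the ball may reach $\tau d$, so vertices of
degree at least $(1+s)d$ receive a larger weight. This is affordable because, with high probability,
every vertex has few such neighbours (`binomialRandom_real_highNbrs_le`). The radii are large enough
when $\log N\gtrsim d^{3/4}$ (`le_rVert`); otherwise $\mathcal V_\tau$ is empty with high
probability and there is nothing to prove. -/

noncomputable section

namespace ERGraph

variable {N : ℕ}

/-! ### Chernoff bounds for degrees and for neighbours of high degree. -/

section Probability

/-- Summing products of edge weights over all subsets of a finite set of edges. -/
theorem sum_powerset_weight {ι : Type*} [DecidableEq ι] (U : Finset ι) (p : ℝ) (g h : ι → ℝ) :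
    ∑ s ∈ U.powerset, p ^ s.card * (1 - p) ^ (U \ s).card *
      ((∏ e ∈ s, g e) * ∏ e ∈ U \ s, h e) = ∏ e ∈ U, (p * g e + (1 - p) * h e) := by
  rw [Finset.prod_add]
  refine Finset.sum_congr rfl fun s _ => ?_
  rw [Finset.prod_mul_distrib, Finset.prod_mul_distrib, Finset.prod_const, Finset.prod_const]
  ring

open scoped Classical in
/-- The probability of a singleton for the binomial random graph. -/
theorem binomialRandom_real_singleton (p : unitInterval) (G : SimpleGraph (Fin N)) :
    (binomialRandom (Fin N) p).real {G} =
      (p : ℝ) ^ G.edgeFinset.card *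
        (1 - (p : ℝ)) ^ ((Finset.univ.filter fun e : Sym2 (Fin N) => ¬ e.IsDiag) \
          G.edgeFinset).card := by
  have hsub : G.edgeFinset ⊆ Finset.univ.filter fun e : Sym2 (Fin N) => ¬ e.IsDiag := by
    intro e he
    simp only [Finset.mem_filter, Finset.mem_univ, true_and]
    exact G.not_isDiag_of_mem_edgeSet (by simpa using he)
  have hcard : (Finset.univ.filter fun e : Sym2 (Fin N) => ¬ e.IsDiag).card
      = (Nat.card (Fin N)).choose 2 := by
    rw [Nat.card_eq_fintype_card, ← Sym2.card_diagSet_compl, ← Set.toFinset_card]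
    congr 1
    ext e
    simp
  rw [Finset.card_sdiff_of_subset hsub, hcard, Measure.real, binomialRandom_singleton]
  have : G.edgeSet.ncard = G.edgeFinset.card := by
    rw [← coe_edgeFinset, Set.ncard_coe_finset]
  rw [this, ENNReal.toReal_mul, ENNReal.toReal_pow, ENNReal.toReal_pow]
  simp

open scoped Classical in
/-- Exponential Chebyshev bound for edge counts of the binomial random graph, with a set `E` of
prescribed edges. -/
theorem binomialRandom_real_le (p : unitInterval) (Q : Set (SimpleGraph (Fin N)))
    (E S : Finset (Sym2 (Fin N))) (hES : Disjoint E S) (hE : ∀ e ∈ E, ¬ e.IsDiag)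
    (hS : ∀ e ∈ S, ¬ e.IsDiag) (a J : ℝ) (ha : 0 ≤ a)
    (hQ : ∀ G ∈ Q, (∀ e ∈ E, e ∈ G.edgeSet) ∧ J ≤ ((S.filter fun e => e ∈ G.edgeSet).card : ℝ)) :
    (binomialRandom (Fin N) p).real Q ≤
      (p : ℝ) ^ E.card * Real.exp (S.card * (p * (Real.exp a - 1)) - a * J) := by
  set U : Finset (Sym2 (Fin N)) := Finset.univ.filter fun e : Sym2 (Fin N) => ¬ e.IsDiag with hU
  have hp0 : (0 : ℝ) ≤ p := p.2.1
  have hp1 : (0 : ℝ) ≤ 1 - p := sub_nonneg.2 p.2.2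
  -- Exponential tilt: a present edge of `S` counts $e^a$, an absent edge of `E` counts 0. On `Q`
  -- the tilt is at least $e^{aJ}$, and its expectation factorises over edges.
  set g : Sym2 (Fin N) → ℝ := fun e => if e ∈ S then Real.exp a else 1 with hg
  set h : Sym2 (Fin N) → ℝ := fun e => if e ∈ E then 0 else 1 with hh
  set φ : Finset (Sym2 (Fin N)) → ℝ := fun s => (p : ℝ) ^ s.card * (1 - (p : ℝ)) ^ (U \ s).card *
      ((∏ e ∈ s, g e) * ∏ e ∈ U \ s, h e) with hφ
  have hg0 : ∀ e, 0 ≤ g e := fun e => by simp only [hg]; split_ifs <;> positivity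
  have hh0 : ∀ e, 0 ≤ h e := fun e => by simp only [hh]; split_ifs <;> positivity
  have hφ0 : ∀ s, 0 ≤ φ s := fun s => mul_nonneg (by positivity)
    (mul_nonneg (Finset.prod_nonneg fun e _ => hg0 e) (Finset.prod_nonneg fun e _ => hh0 e))
  have hbound : ∀ G ∈ Q, (binomialRandom (Fin N) p).real {G} ≤
      Real.exp (-(a * J)) * φ G.edgeFinset := by
    intro G hG
    obtain ⟨h1, h2⟩ := hQ G hG
    rw [binomialRandom_real_singleton]
    have e1 : ∏ e ∈ U \ G.edgeFinset, h e = 1 := by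
      refine Finset.prod_eq_one fun e he => ?_
      have : e ∉ E := fun hc => (Finset.mem_sdiff.1 he).2 (by simpa using h1 e hc)
      simp [hh, this]
    have e2 : ∏ e ∈ G.edgeFinset, g e =
        Real.exp (a * (S.filter fun e => e ∈ G.edgeSet).card) := by
      have : G.edgeFinset.filter (fun e => e ∈ S) = S.filter fun e => e ∈ G.edgeSet := by
        ext e; simp [and_comm]
      rw [hg, Finset.prod_ite, Finset.prod_const_one, mul_one, Finset.prod_const, this,
        ← Real.exp_nat_mul, mul_comm]
    have e3 : 1 ≤ Real.exp (-(a * J)) * ∏ e ∈ G.edgeFinset, g e := by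
      rw [e2, ← Real.exp_add]
      refine Real.one_le_exp ?_
      have := mul_le_mul_of_nonneg_left h2 ha
      linarith
    simp only [hφ, e1, mul_one]
    calc _ = ((p : ℝ) ^ G.edgeFinset.card * (1 - (p : ℝ)) ^ (U \ G.edgeFinset).card) * 1 := by
          rw [mul_one]
      _ ≤ ((p : ℝ) ^ G.edgeFinset.card * (1 - (p : ℝ)) ^ (U \ G.edgeFinset).card) *
          (Real.exp (-(a * J)) * ∏ e ∈ G.edgeFinset, g e) :=
        mul_le_mul_of_nonneg_left e3 (by positivity)
      _ = _ := by ring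
  have hsum : (binomialRandom (Fin N) p).real Q ≤
      ∑ G ∈ Finset.univ.filter (fun G => G ∈ Q), (binomialRandom (Fin N) p).real {G} := by
    refine le_of_eq_of_le ?_ (measureReal_biUnion_finset_le _ fun G => {G})
    congr 1
    ext G
    simp
  have hinj : Set.InjOn (fun G : SimpleGraph (Fin N) => G.edgeFinset)
      (Finset.univ.filter (fun G => G ∈ Q) : Finset (SimpleGraph (Fin N))) := by
    intro G _ G' _ hGG
    have : (G.edgeFinset : Set (Sym2 (Fin N))) = (G'.edgeFinset : Set (Sym2 (Fin N))) := by
      simpa using hGG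
    simpa using this
  have hprod : ∑ s ∈ U.powerset, φ s ≤
      (p : ℝ) ^ E.card * Real.exp (S.card * (p * (Real.exp a - 1))) := by
    rw [show ∑ s ∈ U.powerset, φ s = _ from sum_powerset_weight U (p : ℝ) g h]
    have hEU : E ⊆ U := fun e he => by simp [hU, hE e he]
    have hSU : S ⊆ U \ E := fun e he => Finset.mem_sdiff.2
      ⟨by simp [hU, hS e he], fun hc => Finset.disjoint_left.1 hES hc he⟩
    rw [← Finset.prod_sdiff hEU, ← Finset.prod_sdiff hSU, mul_comm]
    have hEp : ∏ e ∈ E, ((p : ℝ) * g e + (1 - (p : ℝ)) * h e) = (p : ℝ) ^ E.card := by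
      rw [← Finset.prod_const]
      refine Finset.prod_congr rfl fun e he => ?_
      have : e ∉ S := Finset.disjoint_left.1 hES he
      simp [hg, hh, he, this]
    have hRp : ∏ e ∈ (U \ E) \ S, ((p : ℝ) * g e + (1 - (p : ℝ)) * h e) = 1 := by
      refine Finset.prod_eq_one fun e he => ?_
      have h1 := (Finset.mem_sdiff.1 he).2
      have h2 := (Finset.mem_sdiff.1 (Finset.mem_sdiff.1 he).1).2
      simp [hg, hh, h1, h2]
    have hSp : ∏ e ∈ S, ((p : ℝ) * g e + (1 - (p : ℝ)) * h e) ≤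
        Real.exp (S.card * (p * (Real.exp a - 1))) := by
      rw [Real.exp_nat_mul, ← Finset.prod_const]
      refine Finset.prod_le_prod (fun e _ => add_nonneg (mul_nonneg hp0 (hg0 e))
        (mul_nonneg hp1 (hh0 e))) fun e he => ?_
      have : e ∉ E := Finset.disjoint_right.1 hES he
      simp only [hg, hh, he, this, if_true, if_false]
      have := Real.add_one_le_exp ((p : ℝ) * (Real.exp a - 1))
      linarith
    rw [hEp, hRp, one_mul]
    exact mul_le_mul_of_nonneg_left hSp (by positivity)
  calc (binomialRandom (Fin N) p).real Q
      ≤ ∑ G ∈ Finset.univ.filter (fun G => G ∈ Q), (binomialRandom (Fin N) p).real {G} := hsum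
    _ ≤ ∑ G ∈ Finset.univ.filter (fun G => G ∈ Q), Real.exp (-(a * J)) * φ G.edgeFinset :=
        Finset.sum_le_sum fun G hG => hbound G (by simpa using hG)
    _ = Real.exp (-(a * J)) *
        ∑ s ∈ (Finset.univ.filter (fun G => G ∈ Q)).image
          (fun G : SimpleGraph (Fin N) => G.edgeFinset), φ s := by
        rw [Finset.sum_image hinj, Finset.mul_sum]
    _ ≤ Real.exp (-(a * J)) * ∑ s ∈ U.powerset, φ s := by
        refine mul_le_mul_of_nonneg_left ?_ (Real.exp_pos _).le
        refine Finset.sum_le_sum_of_subset_of_nonneg ?_ fun s _ _ => hφ0 s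
        intro s hs
        obtain ⟨G, -, rfl⟩ := Finset.mem_image.1 hs
        rw [Finset.mem_powerset]
        intro e he
        simp only [hU, Finset.mem_filter, Finset.mem_univ, true_and]
        exact G.not_isDiag_of_mem_edgeSet (by simpa using he)
    _ ≤ Real.exp (-(a * J)) * ((p : ℝ) ^ E.card * Real.exp (S.card * (p * (Real.exp a - 1)))) :=
        mul_le_mul_of_nonneg_left hprod (Real.exp_pos _).le
    _ = _ := by rw [sub_eq_neg_add (_ * _) (a * J), Real.exp_add]; ring

/-- The upper Chernoff bound for the degree of a vertex. -/
theorem binomialRandom_real_deg_ge (p : unitInterval) (x : Fin N) (a J : ℝ) (ha : 0 ≤ a) :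
    (binomialRandom (Fin N) p).real {G | J ≤ (deg G x : ℝ)} ≤
      Real.exp (N * p * (Real.exp a - 1) - a * J) := by
  classical
  have hp0 : (0 : ℝ) ≤ p := p.2.1
  have hinj : Set.InjOn (fun v => s(x, v)) (Finset.univ.erase x : Finset (Fin N)) := by
    intro v _ v' _ h
    exact Sym2.congr_right.1 h
  refine (binomialRandom_real_le p _ ∅ ((Finset.univ.erase x).image fun v => s(x, v))
    (Finset.disjoint_empty_left _) (by simp) ?_ a J ha ?_).trans ?_
  · intro e he
    obtain ⟨v, hv, rfl⟩ := Finset.mem_image.1 he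
    simpa using (Finset.ne_of_mem_erase hv).symm
  · intro G hG
    refine ⟨by simp, le_trans hG ?_⟩
    rw [Finset.filter_image, Finset.card_image_of_injOn
      (hinj.mono (by intro v hv; exact (Finset.mem_filter.1 hv).1)), deg,
      ← card_neighborFinset_eq_degree]
    refine Nat.cast_le.2 (Finset.card_le_card fun v hv => ?_)
    have hv : G.Adj x v := by simpa using hv
    simp [hv, hv.ne']
  · rw [Finset.card_empty, pow_zero, one_mul, Finset.card_image_of_injOn hinj]
    refine Real.exp_le_exp.2 (sub_le_sub_right ?_ _)
    rw [mul_assoc]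
    refine mul_le_mul_of_nonneg_right ?_
      (mul_nonneg hp0 (sub_nonneg.2 (Real.one_le_exp ha)))
    exact_mod_cast (Finset.card_le_univ _).trans (by simp)

/-- The probability that all vertices in `Z` have high degree and are adjacent to `y`. -/
theorem binomialRandom_real_adj_deg_ge (p : unitInterval) (d s : ℝ) (hd : (N : ℝ) * p = d)
    (hs : 0 ≤ s) (hs1 : s ≤ 1) (y : Fin N) (Z : Finset (Fin N)) (hy : y ∉ Z)
    (hZ : (Z.card : ℝ) ≤ s * d / 4) :
    (binomialRandom (Fin N) p).real {G | ∀ z ∈ Z, G.Adj y z ∧ (1 + s) * d ≤ (deg G z : ℝ)} ≤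
      (p : ℝ) ^ Z.card * Real.exp (-(Z.card * (d * s ^ 2 / 8))) := by
  classical
  have hp0 : (0 : ℝ) ≤ p := p.2.1
  -- The pairs in `Z ×ˢ W` are distinct edges, hence independent. Restricting to `W` costs each `z`
  -- at most `Z.card` neighbours: `y` and the rest of `Z`.
  set W : Finset (Fin N) := (insert y Z)ᶜ with hW
  have hWZ : ∀ v ∈ W, v ≠ y ∧ v ∉ Z := by
    intro v hv
    simpa [hW, not_or] using hv
  have hinjE : Set.InjOn (fun z => s(y, z)) (Z : Set (Fin N)) := by
    intro v _ v' _ h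
    exact Sym2.congr_right.1 h
  have hinj : Set.InjOn (fun q : Fin N × Fin N => s(q.1, q.2)) (Z ×ˢ W : Finset _) := by
    rintro ⟨z, v⟩ hq ⟨z', v'⟩ hq' h
    simp only [Finset.coe_product, Set.mem_prod, Finset.mem_coe] at hq hq'
    rcases Sym2.eq_iff.1 h with ⟨h1, h2⟩ | ⟨h1, h2⟩
    · simp only at h1 h2; rw [h1, h2]
    · simp only at h1
      exact absurd (h1 ▸ hq.1) (hWZ _ hq'.2).2
  have hcardE : (Z.image fun z => s(y, z)).card = Z.card := Finset.card_image_of_injOn hinjE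
  have hcardS : ((Z ×ˢ W).image fun q => s(q.1, q.2)).card = Z.card * W.card := by
    rw [Finset.card_image_of_injOn hinj, Finset.card_product]
  refine (binomialRandom_real_le p _ (Z.image fun z => s(y, z))
    ((Z ×ˢ W).image fun q => s(q.1, q.2)) ?_ ?_ ?_ (s / 2)
    (Z.card * ((1 + s) * d - Z.card)) (by positivity) ?_).trans ?_
  · rw [Finset.disjoint_left]
    intro e he he'
    obtain ⟨z, hz, rfl⟩ := Finset.mem_image.1 he
    obtain ⟨⟨z', v⟩, hq, h⟩ := Finset.mem_image.1 he'
    rw [Finset.mem_product] at hq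
    rcases Sym2.eq_iff.1 h with ⟨h1, -⟩ | ⟨-, h2⟩
    · exact hy (h1 ▸ hq.1)
    · exact (hWZ _ hq.2).1 h2
  · intro e he
    obtain ⟨z, hz, rfl⟩ := Finset.mem_image.1 he
    have : y ≠ z := fun h => hy (h ▸ hz)
    simpa using this
  · intro e he
    obtain ⟨⟨z, v⟩, hq, rfl⟩ := Finset.mem_image.1 he
    rw [Finset.mem_product] at hq
    have : z ≠ v := fun h => (hWZ _ hq.2).2 (h ▸ hq.1)
    simpa using this
  · intro G hG
    refine ⟨?_, ?_⟩
    · intro e he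
      obtain ⟨z, hz, rfl⟩ := Finset.mem_image.1 he
      exact (hG z hz).1
    · rw [Finset.filter_image, Finset.card_image_of_injOn
        (hinj.mono (by intro v hv; exact (Finset.mem_filter.1 hv).1))]
      have hfib : ((Z ×ˢ W).filter fun q => s(q.1, q.2) ∈ G.edgeSet).card =
          ∑ z ∈ Z, (W.filter fun v => G.Adj z v).card := by
        rw [Finset.card_filter, Finset.sum_product]
        refine Finset.sum_congr rfl fun z _ => ?_
        rw [Finset.card_filter]
        simp
      rw [hfib, ← nsmul_eq_mul, Nat.cast_sum]
      refine Finset.card_nsmul_le_sum _ _ _ fun z hz => ?_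
      have h1 : deg G z ≤ (W.filter fun v => G.Adj z v).card + Z.card := by
        rw [deg, ← card_neighborFinset_eq_degree]
        have hsub : G.neighborFinset z ⊆ (W.filter fun v => G.Adj z v) ∪ (insert y Z).erase z := by
          intro v hv
          have hv : G.Adj z v := by simpa using hv
          rw [Finset.mem_union]
          by_cases hvW : v ∈ W
          · exact Or.inl (Finset.mem_filter.2 ⟨hvW, hv⟩)
          · right
            rw [hW, Finset.mem_compl, not_not] at hvW
            exact Finset.mem_erase.2 ⟨hv.ne', hvW⟩
        refine (Finset.card_le_card hsub).trans ((Finset.card_union_le _ _).trans ?_)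
        have h2 : ((insert y Z).erase z).card = Z.card := by
          rw [Finset.card_erase_of_mem (Finset.mem_insert_of_mem hz),
            Finset.card_insert_of_notMem hy]
          simp
        rw [h2]
      have h2 := (hG z hz).2
      have h3 : (deg G z : ℝ) ≤ ((W.filter fun v => G.Adj z v).card : ℝ) + Z.card := by
        exact_mod_cast h1
      linarith
  · rw [hcardE, hcardS]
    refine mul_le_mul_of_nonneg_left (Real.exp_le_exp.2 ?_) (by positivity)
    have hexp : Real.exp (s / 2) - 1 ≤ s / 2 + (s / 2) ^ 2 := by
      have := Real.abs_exp_sub_one_sub_id_le (x := s / 2) (by rw [abs_le]; constructor <;> linarith)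
      have := (abs_le.1 this).2
      linarith
    have hexp0 : 0 ≤ Real.exp (s / 2) - 1 := sub_nonneg.2 (Real.one_le_exp (by positivity))
    have hWN : (W.card : ℝ) ≤ N := by
      exact_mod_cast (Finset.card_le_univ W).trans (by simp)
    have hd0 : 0 ≤ d := by rw [← hd]; positivity
    have h1 : (W.card : ℝ) * (p * (Real.exp (s / 2) - 1)) ≤ d * (s / 2 + (s / 2) ^ 2) := by
      calc (W.card : ℝ) * (p * (Real.exp (s / 2) - 1))
          ≤ N * (p * (Real.exp (s / 2) - 1)) := by gcongr
        _ = d * (Real.exp (s / 2) - 1) := by rw [← hd]; ring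
        _ ≤ _ := by gcongr
    have h2 : s / 2 * (Z.card : ℝ) ≤ s / 2 * (s * d / 4) := by gcongr
    have hZ0 : (0 : ℝ) ≤ Z.card := by positivity
    -- With tilt $s/2$ and $|Z|\le sd/4$ the coefficients of $ds^2$ add up to $1/4-1/2+1/8=-1/8$.
    have h3 : (W.card : ℝ) * (p * (Real.exp (s / 2) - 1)) - s / 2 * ((1 + s) * d - Z.card) ≤
        -(d * s ^ 2 / 8) := by nlinarith
    have h4 := mul_le_mul_of_nonneg_left h3 hZ0
    push_cast
    linarith

open scoped Classical in
/-- The neighbours of `y` with degree at least `(1 + s) d`. -/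
def highNbrs (d s : ℝ) (G : SimpleGraph (Fin N)) (y : Fin N) : Finset (Fin N) :=
  Finset.univ.filter fun z => G.Adj y z ∧ (1 + s) * d ≤ (deg G z : ℝ)

/-- Union bound over `y` and over the `k`-element sets of its neighbours: the number of sets, at
most $N^k$, combines with $p^k$ into $d^k$. -/
theorem binomialRandom_real_highNbrs (p : unitInterval) (d s : ℝ) (hd : (N : ℝ) * p = d)
    (hs : 0 ≤ s) (hs1 : s ≤ 1) (k : ℕ) (hk : (k : ℝ) ≤ s * d / 4) :
    (binomialRandom (Fin N) p).real {G | ∃ y, k ≤ (highNbrs d s G y).card} ≤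
      N * (d ^ k * Real.exp (-(k * (d * s ^ 2 / 8)))) := by
  classical
  have hp0 : (0 : ℝ) ≤ p := p.2.1
  have hset : {G : SimpleGraph (Fin N) | ∃ y, k ≤ (highNbrs d s G y).card} ⊆
      ⋃ y ∈ (Finset.univ : Finset (Fin N)), ⋃ Z ∈ Finset.powersetCard k (Finset.univ.erase y),
        {G | ∀ z ∈ Z, G.Adj y z ∧ (1 + s) * d ≤ (deg G z : ℝ)} := by
    rintro G ⟨y, hy⟩
    obtain ⟨Z, hZ, hZk⟩ := Finset.exists_subset_card_eq hy
    have hmem : ∀ z ∈ Z, G.Adj y z ∧ (1 + s) * d ≤ (deg G z : ℝ) := fun z hz => by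
      simpa [highNbrs] using hZ hz
    simp only [Set.mem_iUnion]
    refine ⟨y, Finset.mem_univ _, Z, Finset.mem_powersetCard.2 ⟨fun z hz => ?_, hZk⟩, hmem⟩
    simpa using (hmem z hz).1.ne'
  refine (measureReal_mono hset (measure_ne_top _ _)).trans ((measureReal_biUnion_finset_le _ _).trans ?_)
  have hy : ∀ y ∈ (Finset.univ : Finset (Fin N)), (binomialRandom (Fin N) p).real
      (⋃ Z ∈ Finset.powersetCard k (Finset.univ.erase y),
        {G | ∀ z ∈ Z, G.Adj y z ∧ (1 + s) * d ≤ (deg G z : ℝ)}) ≤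
      d ^ k * Real.exp (-(k * (d * s ^ 2 / 8))) := by
    intro y _
    refine (measureReal_biUnion_finset_le _ _).trans ?_
    have hZ : ∀ Z ∈ Finset.powersetCard k (Finset.univ.erase y), (binomialRandom (Fin N) p).real
        {G | ∀ z ∈ Z, G.Adj y z ∧ (1 + s) * d ≤ (deg G z : ℝ)} ≤
        (p : ℝ) ^ k * Real.exp (-(k * (d * s ^ 2 / 8))) := by
      intro Z hZ
      obtain ⟨h1, h2⟩ := Finset.mem_powersetCard.1 hZ
      have hyZ : y ∉ Z := fun h => by simpa using h1 h
      have := binomialRandom_real_adj_deg_ge p d s hd hs hs1 y Z hyZ (by rw [h2]; exact hk)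
      rwa [h2] at this
    refine (Finset.sum_le_sum hZ).trans ?_
    rw [Finset.sum_const, nsmul_eq_mul, ← mul_assoc]
    refine mul_le_mul_of_nonneg_right ?_ (Real.exp_pos _).le
    rw [Finset.card_powersetCard, ← hd, mul_pow]
    refine mul_le_mul_of_nonneg_right ?_ (by positivity)
    have h1 : ((Finset.univ.erase y).card).choose k ≤ N ^ k :=
      (Nat.choose_le_pow _ _).trans
        (Nat.pow_le_pow_left ((Finset.card_le_univ _).trans (by simp)) _)
    exact_mod_cast h1
  refine (Finset.sum_le_sum hy).trans ?_
  simp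

end Probability

/-! ### Supersolutions, Neumann sums and localization. -/

section LinearAlgebra

open Matrix

variable {V : Type*} [Fintype V]

/-- The Schur test: a positive supersolution bounds the Euclidean operator norm. -/
theorem schur_test (M : Matrix V V ℝ) (hM : M.IsSymm) (hM0 : ∀ y z, 0 ≤ M y z) (f : V → ℝ)
    (hf : ∀ y, 0 < f y) (r : ℝ) (hr : 0 ≤ r) (h : ∀ y, (M *ᵥ f) y ≤ r * f y) (v : V → ℝ) :
    ∑ y, (M *ᵥ v) y ^ 2 ≤ r ^ 2 * ∑ y, v y ^ 2 := by
  have h1 : ∀ y, (M *ᵥ v) y ^ 2 ≤ r * f y * ∑ z, M y z * (v z ^ 2 / f z) := by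
    intro y
    -- Cauchy–Schwarz after writing $v_z=\sqrt{f_z}\cdot v_z/\sqrt{f_z}$.
    have hcs : (M *ᵥ v) y ^ 2 ≤ (∑ z, M y z * f z) * ∑ z, M y z * (v z ^ 2 / f z) := by
      refine Finset.sum_sq_le_sum_mul_sum_of_sq_le_mul _
        (fun z _ => mul_nonneg (hM0 y z) (hf z).le)
        (fun z _ => mul_nonneg (hM0 y z) (div_nonneg (sq_nonneg _) (hf z).le)) fun z _ => ?_
      have := (hf z).ne'
      refine le_of_eq ?_
      field_simp
    refine hcs.trans (mul_le_mul_of_nonneg_right (h y) ?_)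
    exact Finset.sum_nonneg fun z _ => mul_nonneg (hM0 y z) (div_nonneg (sq_nonneg _) (hf z).le)
  calc ∑ y, (M *ᵥ v) y ^ 2 ≤ ∑ y, r * f y * ∑ z, M y z * (v z ^ 2 / f z) :=
        Finset.sum_le_sum fun y _ => h1 y
    _ = r * ∑ z, (v z ^ 2 / f z) * (M *ᵥ f) z := by
        simp only [mulVec, dotProduct, Finset.mul_sum]
        rw [Finset.sum_comm]
        refine Finset.sum_congr rfl fun z _ => Finset.sum_congr rfl fun y _ => ?_
        rw [hM.apply y z]
        ring
    _ ≤ r * ∑ z, (v z ^ 2 / f z) * (r * f z) := by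
        refine mul_le_mul_of_nonneg_left (Finset.sum_le_sum fun z _ => ?_) hr
        exact mul_le_mul_of_nonneg_left (h z) (div_nonneg (sq_nonneg _) (hf z).le)
    _ = r ^ 2 * ∑ y, v y ^ 2 := by
        rw [Finset.mul_sum, Finset.mul_sum]
        refine Finset.sum_congr rfl fun z _ => ?_
        have := (hf z).ne'
        field_simp

/-- The iterated Schur test. -/
theorem schur_test_pow [DecidableEq V] (M : Matrix V V ℝ) (hM : M.IsSymm) (hM0 : ∀ y z, 0 ≤ M y z) (f : V → ℝ)
    (hf : ∀ y, 0 < f y) (r : ℝ) (hr : 0 ≤ r) (h : ∀ y, (M *ᵥ f) y ≤ r * f y) (v : V → ℝ) (n : ℕ) :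
    ∑ y, ((M ^ n) *ᵥ v) y ^ 2 ≤ (r ^ 2) ^ n * ∑ y, v y ^ 2 := by
  induction n with
  | zero => simp
  | succ n ih =>
    rw [pow_succ' M, ← mulVec_mulVec]
    refine (schur_test M hM hM0 f hf r hr h _).trans ?_
    rw [pow_succ' (r ^ 2), mul_assoc]
    exact mul_le_mul_of_nonneg_left ih (by positivity)

/-- Partial Neumann sums are dominated by supersolutions. -/
theorem neumann_sum_le [DecidableEq V] (M : Matrix V V ℝ) (hM0 : ∀ y z, 0 ≤ M y z) (b f : V → ℝ)
    (hf : ∀ y, 0 ≤ f y) (μ : ℝ) (hμ : 0 < μ) (h : ∀ y, (M *ᵥ f) y + b y ≤ μ * f y) (n : ℕ) :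
    ∀ y, ∑ j ∈ Finset.range n, ((M ^ j) *ᵥ b) y / μ ^ (j + 1) ≤ f y := by
  induction n with
  | zero => simpa using hf
  | succ n ih =>
    intro y
    -- The partial sums obey $S_{n+1}=(MS_n+b)/\mu$, a monotone iteration that cannot cross a
    -- supersolution.
    have h1 : ∑ j ∈ Finset.range (n + 1), ((M ^ j) *ᵥ b) y / μ ^ (j + 1) =
        ((M *ᵥ fun z => ∑ j ∈ Finset.range n, ((M ^ j) *ᵥ b) z / μ ^ (j + 1)) y + b y) / μ := by
      rw [Finset.sum_range_succ', add_div]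
      congr 1
      · simp only [mulVec, dotProduct]
        simp only [Finset.mul_sum]
        rw [Finset.sum_comm, Finset.sum_div]
        refine Finset.sum_congr rfl fun j _ => ?_
        have : ∀ z, (M ^ (j + 1)) y z = ∑ u, M y u * (M ^ j) u z := fun z => by
          rw [pow_succ', Matrix.mul_apply]
        simp only [this, Finset.sum_mul, Finset.sum_div, Finset.mul_sum]
        rw [Finset.sum_comm]
        refine Finset.sum_congr rfl fun u _ => Finset.sum_congr rfl fun z _ => ?_
        field_simp
        ring
      · simp
    rw [h1, div_le_iff₀ hμ, mul_comm]
    refine le_trans (add_le_add_left ?_ _) (h y)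
    exact Finset.sum_le_sum fun z _ => mul_le_mul_of_nonneg_left (ih z) (hM0 y z)

/-- Exponential localization of a solution of `μ w = M w + x₀ b`, at the value `x₀ = ⟨b, w⟩ / μ`. -/
theorem localization_bound [DecidableEq V] (M : Matrix V V ℝ) (hM : M.IsSymm) (hM0 : ∀ y z, 0 ≤ M y z)
    (b f₁ f₂ w : V → ℝ) (hb : ∀ y, 0 ≤ b y) (hf₁ : ∀ y, 0 < f₁ y) (hf₂ : ∀ y, 0 ≤ f₂ y)
    (r μ x₀ : ℝ) (hr : 0 ≤ r) (hμ : 0 < μ) (h₁ : ∀ y, (M *ᵥ f₁) y ≤ r * f₁ y)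
    (h₂ : ∀ y, (M *ᵥ f₂) y + b y ≤ μ * f₂ y) (n : ℕ) (hx₀ : b ⬝ᵥ w = μ * x₀)
    (hw : ∀ j < n, ∀ y, ((M ^ j) *ᵥ b) y ≠ 0 → μ * w y = (M *ᵥ w) y + x₀ * b y)
    (hpos : 0 ≤ μ - b ⬝ᵥ f₂) :
    x₀ ^ 2 * (μ - b ⬝ᵥ f₂) ^ 2 ≤ ((r / μ) ^ 2) ^ n * (∑ y, b y ^ 2) * ∑ y, w y ^ 2 := by
  -- Pairing the equation with $M^mb$ only uses it on the support of $M^mb$; therefore it may fail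
  -- at the outer boundary of the ball.
  have hid : ∀ m ≤ n, x₀ * (μ - ∑ j ∈ Finset.range m, (((M ^ j) *ᵥ b) ⬝ᵥ b) / μ ^ (j + 1)) =
      (((M ^ m) *ᵥ b) ⬝ᵥ w) / μ ^ m := by
    intro m
    induction m with
    | zero => intro _; simp [hx₀, mul_comm]
    | succ m ih =>
      intro hm
      have h3 : μ * (((M ^ m) *ᵥ b) ⬝ᵥ w) =
          ((M ^ (m + 1)) *ᵥ b) ⬝ᵥ w + x₀ * (((M ^ m) *ᵥ b) ⬝ᵥ b) := by
        have h4 : ((M ^ (m + 1)) *ᵥ b) ⬝ᵥ w = ((M ^ m) *ᵥ b) ⬝ᵥ (M *ᵥ w) := by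
          rw [pow_succ', ← mulVec_mulVec, dotProduct_mulVec, ← mulVec_transpose, hM.eq]
        rw [h4]
        simp only [dotProduct, Finset.mul_sum]
        rw [← Finset.sum_add_distrib]
        refine Finset.sum_congr rfl fun y _ => ?_
        by_cases hy : ((M ^ m) *ᵥ b) y = 0
        · simp [hy]
        · have := hw m (by omega) y hy
          linear_combination ((M ^ m) *ᵥ b) y * this
      rw [Finset.sum_range_succ, ← sub_sub, mul_sub, ih (by omega)]
      rw [show (((M ^ m) *ᵥ b) ⬝ᵥ w) / μ ^ m = (μ * (((M ^ m) *ᵥ b) ⬝ᵥ w)) / μ ^ (m + 1) by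
        rw [pow_succ', mul_div_mul_left _ _ hμ.ne'], h3, add_div]
      ring
  have hle : ∑ j ∈ Finset.range n, (((M ^ j) *ᵥ b) ⬝ᵥ b) / μ ^ (j + 1) ≤ b ⬝ᵥ f₂ := by
    have : ∑ j ∈ Finset.range n, (((M ^ j) *ᵥ b) ⬝ᵥ b) / μ ^ (j + 1) =
        ∑ y, b y * ∑ j ∈ Finset.range n, ((M ^ j) *ᵥ b) y / μ ^ (j + 1) := by
      simp only [dotProduct, Finset.sum_div, Finset.mul_sum]
      rw [Finset.sum_comm]
      refine Finset.sum_congr rfl fun y _ => Finset.sum_congr rfl fun j _ => ?_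
      ring
    rw [this]
    exact Finset.sum_le_sum fun y _ =>
      mul_le_mul_of_nonneg_left (neumann_sum_le M hM0 b f₂ hf₂ μ hμ h₂ n y) (hb y)
  calc x₀ ^ 2 * (μ - b ⬝ᵥ f₂) ^ 2
      ≤ x₀ ^ 2 * (μ - ∑ j ∈ Finset.range n, (((M ^ j) *ᵥ b) ⬝ᵥ b) / μ ^ (j + 1)) ^ 2 := by
        gcongr
    _ = (((M ^ n) *ᵥ b) ⬝ᵥ w) ^ 2 / (μ ^ n) ^ 2 := by
        rw [← mul_pow, hid n le_rfl, div_pow]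
    _ ≤ ((∑ y, ((M ^ n) *ᵥ b) y ^ 2) * ∑ y, w y ^ 2) / (μ ^ n) ^ 2 := by
        gcongr
        exact Finset.sum_mul_sq_le_sq_mul_sq _ _ _
    _ ≤ (((r ^ 2) ^ n * ∑ y, b y ^ 2) * ∑ y, w y ^ 2) / (μ ^ n) ^ 2 := by
        gcongr
        exact schur_test_pow M hM hM0 f₁ hf₁ r hr h₁ b n
    _ = _ := by
        rw [div_pow, div_pow, ← pow_mul μ 2 n, ← pow_mul μ n 2, mul_comm n 2]
        ring

end LinearAlgebra

/-! ### Local tree structure and separation in the pruned graph. -/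

section Pruning

theorem pruned_le (d τ : ℝ) (G : SimpleGraph (Fin N)) : pruned d τ G ≤ G :=
  deleteEdges_le _

/-- A shortest walk to a neighbour of `y` which is no further from `x` than `y` avoids `y`. -/
theorem exists_isPath_concat {V : Type*} {H : SimpleGraph V} {x y p : V} (hr : H.Reachable x y)
    (h : H.Adj p y) (hle : H.dist x p ≤ H.dist x y) :
    ∃ P : H.Walk x p, P.length = H.dist x p ∧ (P.concat h).IsPath := by
  classical
  obtain ⟨P, hP, hPl⟩ := (hr.trans h.symm.reachable).exists_path_of_dist
  refine ⟨P, hPl, hP.concat ?_ h⟩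
  intro hy
  have h1 := dist_le (P.takeUntil y hy)
  have h2 : (P.takeUntil y hy).length < P.length := P.length_takeUntil_lt_length hy h.ne'
  omega

/-- The support of a path starting at `y` which avoids `x` is contained in the branch of `y`. -/
theorem mem_branch_of_mem_support {G : SimpleGraph (Fin N)} {x y u : Fin N} (R : G.Walk y u)
    (hR : R.IsPath) (hl : R.length ≤ rStar G x) (hx : x ∉ R.support) :
    ∀ z ∈ R.support, z ∈ branch G x y := by
  intro z hz
  refine ⟨R.takeUntil z hz, hR.takeUntil hz, (R.length_takeUntil_le_length hz).trans hl, fun he => ?_⟩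
  exact hx (R.fst_mem_support_of_mem_edges (R.edges_takeUntil_subset_edges hz he))

/-- In the pruned graph, vertices close to a vertex of large degree have a unique neighbour that
is not further away. -/
theorem pruned_unique_parent {d τ : ℝ} {G : SimpleGraph (Fin N)} {x y p q : Fin N}
    (hx : x ∈ largeDeg d τ G) (hr : (pruned d τ G).Reachable x y)
    (hy : 2 * (pruned d τ G).dist x y + 1 ≤ rStar G x)
    (hp : (pruned d τ G).Adj y p) (hq : (pruned d τ G).Adj y q)
    (hpd : (pruned d τ G).dist x p ≤ (pruned d τ G).dist x y)
    (hqd : (pruned d τ G).dist x q ≤ (pruned d τ G).dist x y) : p = q := by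
  classical
  set H := pruned d τ G with hH
  have hHG : H ≤ G := pruned_le d τ G
  obtain ⟨P, hPl, hP⟩ := exists_isPath_concat hr hp.symm hpd
  obtain ⟨Q, hQl, hQ⟩ := exists_isPath_concat hr hq.symm hqd
  have hpen : (P.concat hp.symm).penultimate = p := Walk.penultimate_concat _ _
  have hqen : (Q.concat hq.symm).penultimate = q := Walk.penultimate_concat _ _
  have hPl' : (P.concat hp.symm).length = H.dist x p + 1 := by rw [Walk.length_concat, hPl]
  have hQl' : (Q.concat hq.symm).length = H.dist x q + 1 := by rw [Walk.length_concat, hQl]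
  generalize P.concat hp.symm = P' at *
  generalize Q.concat hq.symm = Q' at *
  have hcut : ∀ u, H.Adj x u → (G.induce (branch G x u)).IsTree ∧ x ∉ branch G x u := by
    intro u hu
    rw [hH, pruned, deleteEdges_adj] at hu
    by_contra hcon
    refine hu.2 (Or.inl ⟨x, hx, u, hu.1, rfl, ?_⟩)
    by_contra hcon'
    rw [not_or, not_not] at hcon'
    exact hcon hcon'
  cases P' with
  | nil => simp at hPl'
  | @cons _ u _ hu R =>
  cases Q' with
  | nil => simp at hQl'
  | @cons _ v _ hv S =>
  rw [Walk.cons_isPath_iff] at hP hQ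
  simp only [Walk.length_cons] at hPl' hQl'
  set RG : G.Walk u y := R.mapLe hHG with hRG
  set SG : G.Walk v y := S.mapLe hHG with hSG
  have hRp : RG.IsPath := hP.1.mapLe hHG
  have hSp : SG.IsPath := hQ.1.mapLe hHG
  have hRx : x ∉ RG.support := by simpa [hRG] using hP.2
  have hSx : x ∉ SG.support := by simpa [hSG] using hQ.2
  have hRl : RG.length = H.dist x p := by simp [hRG]; omega
  have hSl : SG.length = H.dist x q := by simp [hSG]; omega
  obtain ⟨htree, hxu⟩ := hcut u hu
  -- If both paths from `x` start with the same edge, they continue inside one branch, a tree, and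
  -- so coincide. Otherwise they join into a walk from `u` back to `x` avoiding the edge $\{x,u\}$,
  -- of length at most $2\,\mathrm{dist}+1\le r_x$, which puts `x` in the branch of `u`.
  by_cases huv : u = v
  · subst huv
    have h1 : RG = SG := by
      have hbR := mem_branch_of_mem_support RG hRp (by omega) hRx
      have hbS := mem_branch_of_mem_support SG hSp (by omega) hSx
      have hmap : ∀ (W : G.Walk u y) (hW : ∀ z ∈ W.support, z ∈ branch G x u), W.IsPath →
          (W.induce _ hW).IsPath := by
        intro W hW hWp
        refine Walk.IsPath.of_map (f := (Embedding.induce (branch G x u)).toHom) ?_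
        rw [Walk.map_induce]
        exact hWp
      have := (htree.isAcyclic.subsingleton_path _ _).elim ⟨_, hmap RG hbR hRp⟩ ⟨_, hmap SG hbS hSp⟩
      have := congrArg (fun W => W.1.map (Embedding.induce (branch G x u)).toHom) this
      simpa [Walk.map_induce] using this
    have h2 : R = S := Walk.map_injective_of_injective Function.injective_id _ _ h1
    rw [← hpen, ← hqen, h2]
  · exfalso
    have hvx : G.Adj v x := hHG hv.symm
    set W : G.Walk u x := (RG.append SG.reverse).concat hvx with hW
    refine hxu ⟨W.bypass, W.bypass_isPath, ?_, fun he => ?_⟩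
    · refine W.length_bypass_le_length.trans ?_
      rw [hW, Walk.length_concat, Walk.length_append, Walk.length_reverse]
      omega
    · have he := W.edges_bypass_subset_edges he
      rw [hW, Walk.edges_concat, List.concat_eq_append, List.mem_append, Walk.edges_append,
        List.mem_append, Walk.edges_reverse, List.mem_reverse, List.mem_singleton] at he
      rcases he with (he | he) | he
      · exact hRx (RG.fst_mem_support_of_mem_edges he)
      · exact hSx (SG.fst_mem_support_of_mem_edges he)
      · rw [Sym2.eq_swap] at he
        exact huv (Sym2.congr_left.1 he)

/-- In the pruned graph, distinct vertices of large degree are far apart. -/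
theorem two_mul_rVert_lt_dist {d τ : ℝ} {G : SimpleGraph (Fin N)} {x y : Fin N}
    (hx : x ∈ largeDeg d τ G) (hy : y ∈ largeDeg d τ G) (hxy : y ≠ x)
    (hr : (pruned d τ G).Reachable x y) : 2 * rVert d τ G x < (pruned d τ G).dist x y := by
  by_contra! hle
  obtain ⟨P, hP, hPl⟩ := hr.exists_path_of_dist
  have hle' : pruned d τ G ≤ G.deleteEdges (cutOne d τ G) :=
    deleteEdges_anti Set.subset_union_left
  cases P with
  | nil => exact hxy rfl
  | @cons _ u _ hu R =>
  -- The first edge of a short path to another vertex of $\mathcal V_\tau$ would itself have been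
  -- cut.
  have h2 : s(x, u) ∈ cutTwo d τ G := by
    refine ⟨x, hx, y, hy, hxy, (Walk.cons hu R).mapLe hle', hP.mapLe hle', ?_, ?_, by simp⟩
    · rw [Walk.length_map, hPl]
      exact hle
    · simp
  rw [pruned, deleteEdges_adj] at hu
  exact hu.2 (Or.inr h2)

end Pruning

/-! ### Functions on rooted trees with prescribed ratios. -/

section Supersolution

variable {V : Type*}

/-- A vertex at positive distance has a neighbour one step closer. -/
theorem exists_adj_dist_succ {H : SimpleGraph V} {x y : V} (hr : H.Reachable x y) (hne : x ≠ y) :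
    ∃ p, H.Adj y p ∧ H.dist x p + 1 = H.dist x y := by
  obtain ⟨P, hP⟩ := hr.symm.exists_walk_length_eq_dist
  cases P with
  | nil => exact absurd rfl hne
  | @cons _ p _ h R =>
    refine ⟨p, h, ?_⟩
    have h1 := dist_le R
    have h2 := hr.dist_triangle_left p
    have h3 : H.dist x y ≤ H.dist x p + 1 := by
      have := (hr.trans h.reachable).dist_triangle_left y
      rwa [dist_eq_one_iff_adj.2 h.symm] at this
    rw [Walk.length_cons, dist_comm] at hP
    rw [dist_comm] at h1
    omega

/-- Existence of positive functions with prescribed ratios along the edges of a rooted tree. -/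
theorem exists_ratio_function (H : SimpleGraph V) (x : V) (n : ℕ)
    (huniq : ∀ y, H.Reachable x y → H.dist x y ≤ n → ∀ p q, H.Adj y p → H.Adj y q →
      H.dist x p ≤ H.dist x y → H.dist x q ≤ H.dist x y → p = q)
    (g : V → ℝ) (hg : ∀ y, 0 < g y) :
    ∃ f : V → ℝ, f x = 1 ∧ (∀ y, 0 < f y) ∧ ∀ y p, H.Reachable x y → y ≠ x → H.dist x y ≤ n →
      H.Adj y p → H.dist x p ≤ H.dist x y → f y = g y * f p := by
  classical
  have hpar : ∀ y, ∃ p, H.Reachable x y → x ≠ y → H.Adj y p ∧ H.dist x p + 1 = H.dist x y := by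
    intro y
    by_cases h : H.Reachable x y ∧ x ≠ y
    · obtain ⟨p, hp⟩ := exists_adj_dist_succ h.1 h.2
      exact ⟨p, fun _ _ => hp⟩
    · exact ⟨y, fun h1 h2 => absurd ⟨h1, h2⟩ h⟩
  choose par hpar using hpar
  -- `F m y` multiplies `g` over `m` successive ancestors, starting with `y`; taking `m` to be the
  -- distance to the root stops at the root with value 1.
  set F : ℕ → V → ℝ := fun m => Nat.rec (fun _ => 1) (fun _ φ y => g y * φ (par y)) m with hF
  have hpos : ∀ m y, 0 < F m y := by
    intro m
    induction m with
    | zero => intro y; exact one_pos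
    | succ m ih => intro y; exact mul_pos (hg y) (ih _)
  refine ⟨fun y => F (H.dist x y) y, by simp [hF], fun y => hpos _ _, ?_⟩
  intro y p hr hne hn hp hpd
  obtain ⟨h1, h2⟩ := hpar y hr hne.symm
  have hpp : p = par y := huniq y hr hn p (par y) hp h1 hpd (by omega)
  subst hpp
  show F (H.dist x y) y = g y * F (H.dist x (par y)) (par y)
  rw [← h2]

end Supersolution

/-! ### Decay of an eigenvector around one vertex. -/

section LocalEstimate

open scoped Classical in
/-- The sum of the weights over the neighbours of a vertex, where neighbours of high degree have
the larger weight. -/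
theorem sum_weights_le {d s g q : ℝ} {k : ℕ} {G H : SimpleGraph (Fin N)} (hHG : H ≤ G)
    (hg : 0 ≤ g) (hq : 0 ≤ q) (hk : ∀ y, (highNbrs d s G y).card ≤ k) (y : Fin N) :
    ∑ z ∈ Finset.univ.filter (fun z => H.Adj y z),
      (if (1 + s) * d ≤ (deg G z : ℝ) then q else g) ≤ deg G y * g + k * q := by
  calc ∑ z ∈ Finset.univ.filter (fun z => H.Adj y z),
      (if (1 + s) * d ≤ (deg G z : ℝ) then q else g)
      ≤ ∑ z ∈ Finset.univ.filter (fun z => G.Adj y z),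
        (g + if (1 + s) * d ≤ (deg G z : ℝ) then q else 0) := by
        refine (Finset.sum_le_sum (g := fun z => g + if (1 + s) * d ≤ (deg G z : ℝ) then q else 0)
          fun z _ => ?_).trans (Finset.sum_le_sum_of_subset_of_nonneg ?_ fun z _ _ => ?_)
        · split_ifs <;> linarith
        · exact Finset.monotone_filter_right _ fun z _ h => hHG h
        · split_ifs <;> linarith
    _ = deg G y * g + (highNbrs d s G y).card * q := by
        rw [Finset.sum_add_distrib, Finset.sum_const, nsmul_eq_mul, ← Finset.sum_filter,
          Finset.filter_filter, Finset.sum_const, nsmul_eq_mul, highNbrs, deg,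
          ← card_neighborFinset_eq_degree, neighborFinset_eq_filter]
    _ ≤ _ := by
        have : ((highNbrs d s G y).card : ℝ) ≤ k := by exact_mod_cast hk y
        gcongr

/-- Separation read as a degree bound. It controls the branching in the supersolutions and, as
$\tau\le2$, keeps the ball inside $V_l$. -/
theorem deg_lt_of_dist_le {d τ : ℝ} {G : SimpleGraph (Fin N)} {x : Fin N}
    (hx : x ∈ largeDeg d τ G) {m : ℕ} (hm : (m : ℝ) ≤ 2 * rVert d τ G x) {y : Fin N}
    (hr : (pruned d τ G).Reachable x y) (hne : y ≠ x) (hy : (pruned d τ G).dist x y ≤ m) :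
    (deg G y : ℝ) < τ * d := by
  by_contra! h
  have h1 := two_mul_rVert_lt_dist hx h hne hr
  have h2 : ((pruned d τ G).dist x y : ℝ) ≤ m := by exact_mod_cast hy
  linarith

open scoped Classical in
/-- Positive supersolutions of the eigenvalue equation of the pruned graph near a vertex of large
degree. -/
theorem exists_supersolution {d τ s g q t : ℝ} {k m : ℕ} {G : SimpleGraph (Fin N)} {x : Fin N}
    (hd : 0 < d) (hτ : τ ≤ 2) (hx : x ∈ largeDeg d τ G) (hm : 2 * m + 1 ≤ rStar G x)
    (hm' : (m : ℝ) ≤ 2 * rVert d τ G x) (hk : ∀ y, (highNbrs d s G y).card ≤ k)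
    (hg : 0 < g) (hq : 0 < q) (h₁ : 1 / g + (1 + s) * g + k * q / d ≤ t)
    (h₂ : 1 / q + 2 * g + k * q / d ≤ t) :
    ∃ f : Fin N → ℝ, f x = 1 ∧ (∀ y, 0 < f y) ∧
      (∀ y, (pruned d τ G).Reachable x y → y ≠ x → (pruned d τ G).dist x y ≤ m →
        ∑ z ∈ Finset.univ.filter (fun z => (pruned d τ G).Adj y z ∧ (pruned d τ G).dist x z ≤ m),
          f z ≤ √d * t * f y) ∧
      (1 ≤ m → ∑ z ∈ Finset.univ.filter (fun z => (pruned d τ G).Adj x z), f z ≤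
        √d * (normDeg d G x * g + k * q / d)) := by
  set H := pruned d τ G with hH
  have hsd : 0 < √d := Real.sqrt_pos.2 hd
  have hss : √d * √d = d := Real.mul_self_sqrt hd.le
  -- Ratio of the value at a vertex to that at its parent: `q / √d` at vertices of degree at least
  -- $(1+s)d$, `g / √d` elsewhere.
  set r : Fin N → ℝ := fun z => (if (1 + s) * d ≤ (deg G z : ℝ) then q else g) / √d with hr
  have hr0 : ∀ z, 0 < r z := fun z => by simp only [hr]; split_ifs <;> positivity
  have hrsum : ∀ y, ∑ z ∈ Finset.univ.filter (fun z => H.Adj y z), r z ≤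
      √d * (normDeg d G y * g + k * q / d) := by
    intro y
    rw [hr, ← Finset.sum_div, div_le_iff₀ hsd]
    refine (sum_weights_le (pruned_le d τ G) hg.le hq.le hk y).trans (le_of_eq ?_)
    rw [normDeg]
    field_simp
    rw [Real.sq_sqrt hd.le]
  obtain ⟨f, hfx, hf0, hf⟩ := exists_ratio_function H x m (fun y hry hym p p' hp hp' h h' =>
    pruned_unique_parent hx hry (show 2 * H.dist x y + 1 ≤ _ by omega) hp hp' h h') r hr0
  refine ⟨f, hfx, hf0, ?_, ?_⟩
  · intro y hry hyx hym
    obtain ⟨p, hp, hpd⟩ := exists_adj_dist_succ hry hyx.symm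
    have hfy : f y = r y * f p := hf y p hry hyx hym hp (by omega)
    have hstep : ∀ z ∈ Finset.univ.filter (fun z => H.Adj y z ∧ H.dist x z ≤ m),
        f z ≤ (if z = p then f p else 0) + r z * f y := by
      intro z hz
      obtain ⟨-, hz, hzm⟩ := Finset.mem_filter.1 hz
      split_ifs with hzp
      · rw [hzp]
        have := mul_pos (hr0 p) (hf0 y)
        linarith
      · have hlt : H.dist x y < H.dist x z := by
          by_contra! hle
          exact hzp (pruned_unique_parent hx hry (show 2 * H.dist x y + 1 ≤ _ by omega) hz hp hle
            (show H.dist x p ≤ H.dist x y by omega))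
        have hzx : z ≠ x := by
          rintro rfl
          simp at hlt
        rw [zero_add]
        exact (hf z y (hry.trans hz.reachable) hzx hzm hz.symm hlt.le).le
    have hsum1 : ∑ z ∈ Finset.univ.filter (fun z => H.Adj y z ∧ H.dist x z ≤ m), f z ≤
        f p + (∑ z ∈ Finset.univ.filter (fun z => H.Adj y z), r z) * f y := by
      refine (Finset.sum_le_sum hstep).trans ?_
      rw [Finset.sum_add_distrib, Finset.sum_mul]
      refine add_le_add ?_ (Finset.sum_le_sum_of_subset_of_nonneg ?_ fun z _ _ =>
        (mul_pos (hr0 z) (hf0 y)).le)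
      · rw [Finset.sum_ite_eq']
        split_ifs
        · exact le_rfl
        · exact (hf0 p).le
      · exact Finset.monotone_filter_right _ fun z _ h => h.1
    have hfp : f p = f y / r y := by
      rw [hfy]
      field_simp [(hr0 y).ne']
    have hdeg := deg_lt_of_dist_le hx hm' hry hyx hym
    -- After division by `f y`, the parent contributes `1 / r y` and the children at most the second
    -- term. High-degree `y` use `h₂` with $\alpha_y\le2$, the others `h₁` with $\alpha_y\le1+s$.
    have hkey : 1 / r y + √d * (normDeg d G y * g + k * q / d) ≤ √d * t := by
      by_cases hhigh : (1 + s) * d ≤ (deg G y : ℝ)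
      · have h3 : normDeg d G y ≤ 2 := by
          rw [normDeg, div_le_iff₀ hd]
          nlinarith
        have h4 : 1 / r y = √d * (1 / q) := by
          simp only [hr, if_pos hhigh]
          field_simp
        rw [h4, ← mul_add]
        refine mul_le_mul_of_nonneg_left ?_ hsd.le
        have := mul_le_mul_of_nonneg_right h3 hg.le
        linarith
      · have h3 : normDeg d G y ≤ 1 + s := by
          rw [normDeg, div_le_iff₀ hd]
          linarith
        have h4 : 1 / r y = √d * (1 / g) := by
          simp only [hr, if_neg hhigh]
          field_simp
        rw [h4, ← mul_add]
        refine mul_le_mul_of_nonneg_left ?_ hsd.le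
        have := mul_le_mul_of_nonneg_right h3 hg.le
        linarith
    calc _ ≤ f p + (∑ z ∈ Finset.univ.filter (fun z => H.Adj y z), r z) * f y := hsum1
      _ ≤ f p + √d * (normDeg d G y * g + k * q / d) * f y :=
          add_le_add_right (mul_le_mul_of_nonneg_right (hrsum y) (hf0 y).le) _
      _ = (1 / r y + √d * (normDeg d G y * g + k * q / d)) * f y := by rw [hfp]; ring
      _ ≤ _ := mul_le_mul_of_nonneg_right hkey (hf0 y).le
  · intro hm1
    refine le_trans (le_of_eq (Finset.sum_congr rfl fun z hz => ?_)) (hrsum x)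
    have hz : H.Adj x z := (Finset.mem_filter.1 hz).2
    have := hf z x hz.reachable hz.ne' (by rw [dist_eq_one_iff_adj.2 hz]; exact hm1) hz.symm
      (by simp)
    rw [this, hfx, mul_one]

/-- The arithmetic conditions under which weights solve the supersolution inequalities. -/
theorem weight_conditions {d s g A ζ t : ℝ} {k : ℕ} (hd : 0 < d) (hs : 0 ≤ s) (hg : 0 < g)
    (hg1 : g ≤ 1) (hA : 2 ≤ A) (hAg : 1 / g + g = A * g) (hζ : 0 < ζ) (ht : A * g + ζ ≤ t)
    (hsζ : s ≤ ζ / 4) (hk : 8 * k ≤ d * ζ ^ 2) :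
    1 / g + (1 + s) * g + k * (2 / ζ) / d ≤ t ∧ 1 / (2 / ζ) + 2 * g + k * (2 / ζ) / d ≤ t ∧
      A * g + k * (2 / ζ) / d ≤ t - ζ / 2 := by
  -- The choice $q=2/\zeta$ splits the margin $\zeta$: $1/q=\zeta/2$ for a high-degree vertex,
  -- $kq/d\le\zeta/4$ for its high-degree children.
  have h1 : k * (2 / ζ) / d ≤ ζ / 4 := by
    rw [div_le_iff₀ hd, ← mul_div_assoc, div_le_iff₀ hζ]
    nlinarith
  have h2 : s * g ≤ s := by nlinarith
  have h3 : 2 * g ≤ A * g := by nlinarith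
  have h4 : 1 / (2 / ζ) = ζ / 2 := by rw [one_div_div]
  refine ⟨by linarith, by rw [h4]; linarith, by linarith⟩

open scoped Classical in
/-- A solution of the eigenvalue equation near a vertex `x` of large degree is small at `x`
compared with its mass on a ball around `x`. -/
theorem vertex_bound {d τ s g A ζ t : ℝ} {k n : ℕ} {G : SimpleGraph (Fin N)} {x : Fin N}
    (hd : 0 < d) (hτ : τ ≤ 2) (hx : x ∈ largeDeg d τ G) (hm : 2 * (n + 1) + 1 ≤ rStar G x)
    (hm' : (n + 1 : ℝ) ≤ 2 * rVert d τ G x) (hk : ∀ y, (highNbrs d s G y).card ≤ k)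
    (hs : 0 ≤ s) (hg : 0 < g) (hg1 : g ≤ 1) (hA : 2 ≤ A) (hAg : 1 / g + g = A * g) (hζ : 0 < ζ)
    (ht : A * g + ζ ≤ t) (hxA : normDeg d G x ≤ A) (hsζ : s ≤ ζ / 4) (hkζ : 8 * k ≤ d * ζ ^ 2)
    (ht2 : 2 < t) (hsη : s ≤ (√(2 * t) - 2) / 4) (hkη : 8 * k ≤ d * (√(2 * t) - 2) ^ 2)
    (w : Fin N → ℝ)
    (hw : ∀ y, (pruned d τ G).Reachable x y → (pruned d τ G).dist x y ≤ n →
      √d * t * w y = ∑ z ∈ Finset.univ.filter (fun z => (pruned d τ G).Adj y z), w z) :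
    w x ^ 2 ≤ (2 / t) ^ n * (4 * normDeg d G x / ζ ^ 2) *
      ∑ y ∈ Finset.univ.filter (fun y => (pruned d τ G).Reachable x y ∧
        (pruned d τ G).dist x y ≤ n + 1), w y ^ 2 := by
  have ht0 : 0 < t := by linarith
  have hη : 0 < √(2 * t) - 2 := by
    have : √(2 * 2) < √(2 * t) := Real.sqrt_lt_sqrt (by norm_num) (by linarith)
    rw [Real.sqrt_mul_self (by norm_num)] at this
    linarith
  have hsd : 0 < √d := Real.sqrt_pos.2 hd
  obtain ⟨c1, c2, c3⟩ := weight_conditions hd hs hg hg1 hA hAg hζ ht hsζ hkζ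
  -- The norm bound needs a level strictly between 2 and $t$. The geometric mean $\sqrt{2t}$ serves
  -- as the level, and its distance to 2 plays the role of $\zeta$.
  obtain ⟨e1, e2, -⟩ := weight_conditions (g := 1) (A := 2) (t := √(2 * t)) hd hs one_pos le_rfl
    le_rfl (by norm_num) hη (by linarith) hsη hkη
  obtain ⟨f₂, hf₂x, hf₂0, hf₂, hf₂s⟩ := exists_supersolution hd hτ hx hm (by exact_mod_cast hm') hk
    hg (by positivity) c1 c2
  obtain ⟨f₁, hf₁x, hf₁0, hf₁, -⟩ := exists_supersolution hd hτ hx hm (by exact_mod_cast hm') hk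
    one_pos (by positivity) e1 e2
  set H := pruned d τ G with hH
  -- The punctured ball: `x` is left out of `M` and returns as the source `b`. The radius $n+1$
  -- ensures that points within distance $n$ have all their neighbours in `F` or equal to `x`.
  set F : Finset (Fin N) :=
    Finset.univ.filter (fun y => H.Reachable x y ∧ y ≠ x ∧ H.dist x y ≤ n + 1) with hF
  have memF : ∀ y, y ∈ F ↔ H.Reachable x y ∧ y ≠ x ∧ H.dist x y ≤ n + 1 := fun y => by simp [hF]
  have adjF : ∀ y, H.Adj x y → y ∈ F := fun y hy =>
    (memF y).2 ⟨hy.reachable, hy.ne', by rw [dist_eq_one_iff_adj.2 hy]; omega⟩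
  set M : Matrix (Fin N) (Fin N) ℝ :=
    Matrix.of fun y z => if y ∈ F ∧ z ∈ F ∧ H.Adj y z then 1 else 0 with hM
  set b : Fin N → ℝ := fun y => if H.Adj x y then 1 else 0 with hb
  have hMsymm : M.IsSymm := by
    ext y z
    simp only [hM, Matrix.transpose_apply, Matrix.of_apply]
    congr 1
    rw [H.adj_comm]
    exact propext ⟨fun h => ⟨h.2.1, h.1, h.2.2⟩, fun h => ⟨h.2.1, h.1, h.2.2⟩⟩
  have hM0 : ∀ y z, 0 ≤ M y z := fun y z => by
    simp only [hM, Matrix.of_apply]; split_ifs <;> norm_num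
  have hMv : ∀ v : Fin N → ℝ, ∀ y, M.mulVec v y =
      if y ∈ F then ∑ z ∈ Finset.univ.filter (fun z => z ∈ F ∧ H.Adj y z), v z else 0 := by
    intro v y
    simp only [hM, Matrix.mulVec, dotProduct, Matrix.of_apply, ite_mul, one_mul, zero_mul]
    split_ifs with hy
    · rw [Finset.sum_filter]
      simp [hy]
    · simp [hy]
  have hbdot : ∀ v : Fin N → ℝ, b ⬝ᵥ v = ∑ z ∈ Finset.univ.filter (fun z => H.Adj x z), v z := by
    intro v
    simp [hb, dotProduct, Finset.sum_filter]
  have hdist : ∀ y ∈ F, H.dist x y ≤ n → ∀ z, H.Adj y z → z = x ∨ z ∈ F := by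
    intro y hy hyn z hz
    by_cases hzx : z = x
    · exact Or.inl hzx
    · right
      have hr := ((memF y).1 hy).1
      refine (memF z).2 ⟨hr.trans hz.reachable, hzx, ?_⟩
      have := hr.dist_triangle_left z
      rw [dist_eq_one_iff_adj.2 hz] at this
      omega
  have hsplit : ∀ (P : Fin N → Prop) [DecidablePred P] (y : Fin N) (v : Fin N → ℝ), y ∈ F →
      (∀ z, P z ↔ H.Adj y z ∧ (z = x ∨ z ∈ F)) → ∑ z ∈ Finset.univ.filter P, v z =
      ∑ z ∈ Finset.univ.filter (fun z => z ∈ F ∧ H.Adj y z), v z + v x * b y := by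
    intro P _ y v hy hP
    have hxF : x ∉ F := fun h => ((memF x).1 h).2.1 rfl
    have h1 : Finset.univ.filter P = Finset.univ.filter (fun z => z ∈ F ∧ H.Adj y z) ∪
        (if H.Adj x y then {x} else ∅) := by
      ext z
      simp only [Finset.mem_filter, Finset.mem_univ, true_and, Finset.mem_union, hP]
      by_cases hxy : H.Adj x y
      · rw [if_pos hxy, Finset.mem_singleton]
        constructor
        · rintro ⟨h, h' | h'⟩
          · exact Or.inr h'
          · exact Or.inl ⟨h', h⟩
        · rintro (⟨h, h'⟩ | rfl)
          · exact ⟨h', Or.inr h⟩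
          · exact ⟨hxy.symm, Or.inl rfl⟩
      · rw [if_neg hxy]
        constructor
        · rintro ⟨h, rfl | h'⟩
          · exact absurd h.symm hxy
          · exact Or.inl ⟨h', h⟩
        · rintro (⟨h, h'⟩ | h)
          · exact ⟨h', Or.inr h⟩
          · simp at h
    rw [h1, Finset.sum_union]
    · congr 1
      simp only [hb]
      split_ifs <;> simp
    · rw [Finset.disjoint_left]
      intro z hz hz'
      split_ifs at hz'
      · rw [Finset.mem_singleton] at hz'
        exact hxF (hz' ▸ (Finset.mem_filter.1 hz).2.1)
      · simp at hz'
  have hPF : ∀ y ∈ F, ∀ z, (H.Adj y z ∧ H.dist x z ≤ n + 1) ↔ H.Adj y z ∧ (z = x ∨ z ∈ F) := by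
    intro y hy z
    refine and_congr_right fun hz => ?_
    by_cases hzx : z = x
    · simp [hzx]
    · simp [memF, hzx, ((memF y).1 hy).1.trans hz.reachable]
  have hM₂ : ∀ y, M.mulVec f₂ y + b y ≤ √d * t * f₂ y := by
    intro y
    rw [hMv]
    by_cases hy : y ∈ F
    · rw [if_pos hy]
      obtain ⟨h1, h2, h3⟩ := (memF y).1 hy
      have h4 := hf₂ y h1 h2 h3
      rw [hsplit _ y f₂ hy (hPF y hy), hf₂x, one_mul] at h4
      exact h4
    · have hb0 : b y = 0 := if_neg fun h => hy (adjF y h)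
      rw [if_neg hy, hb0, add_zero]
      have := hf₂0 y
      positivity
  have hM₁ : ∀ y, M.mulVec f₁ y ≤ √d * √(2 * t) * f₁ y := by
    intro y
    rw [hMv]
    split_ifs with hy
    · obtain ⟨h1, h2, h3⟩ := (memF y).1 hy
      have h4 := hf₁ y h1 h2 h3
      rw [hsplit _ y f₁ hy (hPF y hy), hf₁x, one_mul] at h4
      have h5 : 0 ≤ b y := by simp only [hb]; split_ifs <;> norm_num
      linarith
    · have := hf₁0 y
      positivity
  -- For $j<n$ the support of $M^jb$ stays within distance $n$, where the eigenvalue equation holds.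
  have hsupp : ∀ j, ∀ y, ((M ^ j).mulVec b) y ≠ 0 → y ∈ F ∧ H.dist x y ≤ j + 1 := by
    intro j
    induction j with
    | zero =>
      intro y hy
      have hxy : H.Adj x y := by
        by_contra h
        simp [hb, h] at hy
      exact ⟨adjF y hxy, by rw [dist_eq_one_iff_adj.2 hxy]⟩
    | succ j ih =>
      intro y hy
      rw [pow_succ', ← Matrix.mulVec_mulVec, hMv] at hy
      have hyF : y ∈ F := by
        by_contra h
        simp [h] at hy
      rw [if_pos hyF] at hy
      obtain ⟨z, hz, hz'⟩ := Finset.exists_ne_zero_of_sum_ne_zero hy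
      obtain ⟨-, h1, h2⟩ := Finset.mem_filter.1 hz
      have h3 := ih z hz'
      refine ⟨hyF, ?_⟩
      have := ((memF z).1 h1).1.dist_triangle_left y
      rw [dist_eq_one_iff_adj.2 h2.symm] at this
      omega
  set v : Fin N → ℝ := fun y => if y ∈ F then w y else 0 with hv
  have hvF : ∀ y ∈ F, v y = w y := fun y hy => if_pos hy
  have hbv : b ⬝ᵥ v = √d * t * w x := by
    rw [hbdot, hw x (Reachable.refl x) (by simp)]
    exact Finset.sum_congr rfl fun z hz => hvF z (adjF z (Finset.mem_filter.1 hz).2)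
  have hveq : ∀ j < n, ∀ y, ((M ^ j).mulVec b) y ≠ 0 →
      √d * t * v y = M.mulVec v y + w x * b y := by
    intro j hj y hy
    obtain ⟨h1, h2⟩ := hsupp j y hy
    have h3 : H.dist x y ≤ n := by omega
    rw [hvF y h1, hw y ((memF y).1 h1).1 h3, hMv, if_pos h1, hsplit _ y w h1 (fun z =>
      ⟨fun h => ⟨h, hdist y h1 h3 z h⟩, fun h => h.1⟩)]
    congr 1
    exact Finset.sum_congr rfl fun z hz => (hvF z (Finset.mem_filter.1 hz).2.1).symm
  -- The spectral gap at `x`: $\langle b,f_2\rangle$ is the sum of `f₂` over the children of `x`,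
  -- and $\alpha_x g\le Ag\le t-\zeta$.
  have hgap : √d * (ζ / 2) ≤ √d * t - b ⬝ᵥ f₂ := by
    have h1 := hf₂s (by omega)
    rw [← hbdot] at h1
    have h2 : normDeg d G x * g ≤ A * g := mul_le_mul_of_nonneg_right hxA hg.le
    have h3 : √d * (normDeg d G x * g + k * (2 / ζ) / d) ≤ √d * (t - ζ / 2) :=
      mul_le_mul_of_nonneg_left (by linarith) hsd.le
    linarith
  have hgap0 : 0 ≤ √d * (ζ / 2) := by positivity
  have hmain := localization_bound M hMsymm hM0 b f₁ f₂ v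
    (fun y => by simp only [hb]; split_ifs <;> norm_num) hf₁0 (fun y => (hf₂0 y).le)
    (√d * √(2 * t)) (√d * t) (w x) (by positivity) (by positivity) hM₁ hM₂ n hbv hveq
    (hgap0.trans hgap)
  have hratio : (√d * √(2 * t) / (√d * t)) ^ 2 = 2 / t := by
    rw [mul_div_mul_left _ _ hsd.ne', div_pow, Real.sq_sqrt (by positivity)]
    field_simp
  have hbsum : ∑ y, b y ^ 2 ≤ normDeg d G x * d := by
    rw [normDeg, div_mul_cancel₀ _ hd.ne', deg, ← card_neighborFinset_eq_degree,
      neighborFinset_eq_filter]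
    simp only [hb, ite_pow, one_pow, ne_eq, OfNat.ofNat_ne_zero, not_false_eq_true, zero_pow]
    rw [Finset.sum_boole]
    exact_mod_cast Finset.card_le_card
      (Finset.monotone_filter_right _ fun z _ h => pruned_le d τ G h)
  have hvsum : ∑ y, v y ^ 2 ≤ ∑ y ∈ Finset.univ.filter (fun y => H.Reachable x y ∧
        H.dist x y ≤ n + 1), w y ^ 2 := by
    have h1 : ∑ y, v y ^ 2 = ∑ y ∈ F, w y ^ 2 := by
      simp [hv, ite_pow, Finset.sum_ite_mem]
    rw [h1]
    refine Finset.sum_le_sum_of_subset_of_nonneg (fun y hy => ?_) fun _ _ _ => sq_nonneg _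
    obtain ⟨h1, -, h3⟩ := (memF y).1 hy
    simp [h1, h3]
  rw [hratio] at hmain
  set S := ∑ y ∈ Finset.univ.filter (fun y => H.Reachable x y ∧ H.dist x y ≤ n + 1), w y ^ 2
  have hS : 0 ≤ ∑ y, v y ^ 2 := Finset.sum_nonneg fun _ _ => sq_nonneg _
  have ha : 0 ≤ normDeg d G x := div_nonneg (Nat.cast_nonneg _) hd.le
  have hfin : w x ^ 2 * (√d * (ζ / 2)) ^ 2 ≤ (2 / t) ^ n * (normDeg d G x * d) * S := by
    calc w x ^ 2 * (√d * (ζ / 2)) ^ 2 ≤ w x ^ 2 * (√d * t - b ⬝ᵥ f₂) ^ 2 := by gcongr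
      _ ≤ _ := hmain
      _ ≤ _ := by gcongr
  rw [mul_pow, Real.sq_sqrt hd.le] at hfin
  have h5 : (2 / t) ^ n * (4 * normDeg d G x / ζ ^ 2) * S =
      ((2 / t) ^ n * (normDeg d G x * d) * S) / (d * (ζ / 2) ^ 2) := by
    field_simp
    ring
  rw [h5, le_div_iff₀ (by positivity)]
  exact hfin

end LocalEstimate

/-! ### The estimate for a fixed graph satisfying the required bounds. -/

section Deterministic

theorem alphaFun_le_sq {t : ℝ} (ht : 2 ≤ t) : alphaFun t ≤ t ^ 2 := by
  have h : √(t ^ 2 - 4) ≤ t := by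
    rw [Real.sqrt_le_left (by linarith)]
    linarith
  rw [alphaFun]
  nlinarith

/-- The conditions on `g = 1 / √(A - 1)` in terms of `Λ(A)`. -/
theorem lam_weight {A : ℝ} (hA : 2 ≤ A) :
    0 < 1 / √(A - 1) ∧ 1 / √(A - 1) ≤ 1 ∧ 1 / (1 / √(A - 1)) + 1 / √(A - 1) = A * (1 / √(A - 1)) ∧
      A * (1 / √(A - 1)) = Lam A := by
  have h1 : 1 ≤ √(A - 1) := Real.one_le_sqrt.2 (by linarith)
  have h0 : 0 < √(A - 1) := by linarith
  refine ⟨by positivity, (div_le_one h0).2 h1, ?_, by rw [Lam, mul_one_div]⟩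
  have := Real.sq_sqrt (show 0 ≤ A - 1 by linarith)
  rw [one_div_one_div]
  field_simp
  linarith

/-- With $A=a\vee2$, $\Lambda(A)\le t$ means $A^2\le t^2(A-1)$. This trades the factor $\alpha_x$ in
`vertex_bound` for $t^2$. -/
theorem le_sq_of_lam_le {a t : ℝ} (h : Lam (max a 2) ≤ t) : a ≤ t ^ 2 := by
  have hA : 2 ≤ max a 2 := le_max_right _ _
  have ha : a ≤ max a 2 := le_max_left _ _
  set A := max a 2
  have h1 : 1 ≤ √(A - 1) := Real.one_le_sqrt.2 (by linarith)
  have h0 : 0 < √(A - 1) := by linarith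
  have hs := Real.sq_sqrt (show 0 ≤ A - 1 by linarith)
  rw [Lam, div_le_iff₀ h0] at h
  have h2 : A ^ 2 ≤ (t * √(A - 1)) ^ 2 := pow_le_pow_left₀ (by linarith) h 2
  rw [mul_pow, hs] at h2
  nlinarith

/-- Lower bounds for `√(2t) - 2` in terms of `t - 2`. -/
theorem sqrt_two_mul_sub_two {C z t : ℝ} (hC : 8 ≤ C) (hz : 0 < z) (hz1 : z ≤ 1) (ht : 2 < t)
    (h : C * z ≤ t - 2) : z ≤ √(2 * t) - 2 ∧ C / 2 * z ^ 2 ≤ (√(2 * t) - 2) ^ 2 := by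
  have hq := Real.sq_sqrt (show 0 ≤ 2 * t by linarith)
  have hu : 0 < √(2 * t) - 2 := by
    have : √(2 * 2) < √(2 * t) := Real.sqrt_lt_sqrt (by norm_num) (by linarith)
    rw [Real.sqrt_mul_self (by norm_num)] at this
    linarith
  set u := √(2 * t) - 2 with hu'
  -- From $2t=(u+2)^2$ one gets $t-2=u(u+4)/2$, which is linear in $u$ up to constants for $u\le4$
  -- and quadratic beyond.
  have h1 : C * z ≤ u * (u + 4) / 2 := by nlinarith
  have h2 : C / 2 * z ^ 2 ≤ u ^ 2 := by
    rcases le_total u 4 with h4 | h4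
    · have h5 : C * z / 4 ≤ u := by nlinarith
      have h6 : (C * z / 4) ^ 2 ≤ u ^ 2 := pow_le_pow_left₀ (by positivity) h5 2
      have h7 : 0 ≤ C * z ^ 2 * (C - 8) := by
        have : 0 ≤ C - 8 := by linarith
        positivity
      nlinarith
    · have h5 : C * z ≤ u ^ 2 := by nlinarith
      have h6 : C * z ^ 2 ≤ C * z := by nlinarith [mul_pos (show 0 < C by linarith) hz]
      have h7 : 0 ≤ C * z ^ 2 := by positivity
      linarith
  refine ⟨?_, h2⟩
  have h3 : z ^ 2 ≤ u ^ 2 := by nlinarith [sq_nonneg z]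
  exact (sq_le_sq₀ hz.le hu.le).1 h3

/-- The exponential decay on a logarithmic number of spheres beats all other factors. -/
theorem decay_bound {d t ζ : ℝ} {n : ℕ} (hd : 1 ≤ Real.log d) (hd0 : 0 < d) (ht : 2 < t)
    (hn : 12 * Real.log d ≤ n) (hζ1 : d ^ (-(t - 2)) ≤ ζ) (hζ2 : d ^ (-(1 / 4) : ℝ) ≤ ζ) :
    t ^ 2 * ((2 / t) ^ n * (4 * t ^ 2 / ζ ^ 2)) ≤
      1024 * d ^ (-1 * min (t - 2) (Real.log t)) := by
  set L := Real.log d with hL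
  have ht0 : 0 < t := by linarith
  have hexp : ∀ x : ℝ, d ^ x = Real.exp (L * x) := fun x => Real.rpow_def_of_pos hd0 x
  rw [hexp] at hζ1 hζ2 ⊢
  have hζ0 : 0 < ζ := (Real.exp_pos _).trans_le hζ1
  have hpow : (2 / t) ^ n = Real.exp (-(n * Real.log (t / 2))) := by
    rw [← mul_neg, ← Real.log_inv, inv_div, Real.exp_nat_mul, Real.exp_log (by positivity)]
  have hζ : ∀ x : ℝ, Real.exp x ≤ ζ → 1 / ζ ^ 2 ≤ Real.exp (-2 * x) := by
    intro x hx
    have h1 : Real.exp x ^ 2 ≤ ζ ^ 2 := pow_le_pow_left₀ (Real.exp_pos _).le hx 2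
    rw [← Real.exp_nat_mul] at h1
    have h2 : Real.exp (-2 * x) = 1 / Real.exp ((2 : ℕ) * x) := by
      rw [one_div, ← Real.exp_neg]; push_cast; ring_nf
    rw [h2]
    exact one_div_le_one_div_of_le (Real.exp_pos _) h1
  have hrw : t ^ 2 * ((2 / t) ^ n * (4 * t ^ 2 / ζ ^ 2)) =
      4 * t ^ 4 * (Real.exp (-(n * Real.log (t / 2))) * (1 / ζ ^ 2)) := by
    rw [hpow]; ring
  rw [hrw]
  have hlog0 : 0 < Real.log (t / 2) := Real.log_pos (by linarith)
  have hnl : 12 * L * Real.log (t / 2) ≤ n * Real.log (t / 2) :=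
    mul_le_mul_of_nonneg_right hn hlog0.le
  -- For $t\le4$: $(2/t)^n\le d^{-3(t-2)}$, $\zeta^{-2}\le d^{2(t-2)}$ and $4t^4\le1024$. For
  -- $t\ge4$: $(2/t)^n\le d^{-6\log t}$, against $t^4\le d^{4\log t}$ and $\zeta^{-2}\le d^{1/2}$.
  rcases le_total t 4 with h4 | h4
  · have h1 : (t - 2) / 4 ≤ Real.log (t / 2) := by
      have h2 := Real.one_sub_inv_le_log_of_pos (show 0 < t / 2 by positivity)
      have h3 : 1 - (t / 2)⁻¹ = (t - 2) / t := by field_simp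
      have h5 : (t - 2) / 4 ≤ (t - 2) / t := div_le_div_of_nonneg_left (by linarith) ht0 h4
      linarith
    have h2 : Real.exp (-(n * Real.log (t / 2))) * (1 / ζ ^ 2) ≤ Real.exp (L * (-(t - 2))) := by
      refine (mul_le_mul_of_nonneg_left (hζ _ hζ1) (Real.exp_pos _).le).trans ?_
      rw [← Real.exp_add]
      refine Real.exp_le_exp.2 ?_
      nlinarith
    have h3 : Real.exp (L * (-(t - 2))) ≤ Real.exp (L * (-1 * min (t - 2) (Real.log t))) := by
      refine Real.exp_le_exp.2 (mul_le_mul_of_nonneg_left ?_ (by linarith))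
      have := min_le_left (t - 2) (Real.log t)
      linarith
    have h5 : t ^ 4 ≤ 4 ^ 4 := pow_le_pow_left₀ ht0.le h4 4
    calc _ ≤ 4 * t ^ 4 * Real.exp (L * (-1 * min (t - 2) (Real.log t))) := by
          gcongr
          exact h2.trans h3
      _ ≤ 1024 * Real.exp (L * (-1 * min (t - 2) (Real.log t))) :=
          mul_le_mul_of_nonneg_right (by linarith) (Real.exp_pos _).le
  · set T := Real.log t with hT
    have hl2 : Real.log 4 = 2 * Real.log 2 := by
      rw [show (4 : ℝ) = 2 ^ 2 by norm_num, Real.log_pow]; norm_num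
    have hT4 : 2 * Real.log 2 ≤ T := by
      rw [← hl2]; exact Real.log_le_log (by norm_num) h4
    have hlog2 := Real.log_two_gt_d9
    have hT1 : 1 ≤ T := by linarith
    have h1 : T / 2 ≤ Real.log (t / 2) := by
      rw [Real.log_div ht0.ne' (by norm_num)]
      linarith
    have ht4 : t ^ 4 = Real.exp (4 * T) := by
      rw [show (4 : ℝ) * T = (4 : ℕ) * T by norm_num, Real.exp_nat_mul, hT, Real.exp_log ht0]
    have h2 : t ^ 4 * (Real.exp (-(n * Real.log (t / 2))) * (1 / ζ ^ 2)) ≤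
        Real.exp (L * (-1 * min (t - 2) T)) := by
      rw [ht4]
      refine (mul_le_mul_of_nonneg_left (mul_le_mul_of_nonneg_left (hζ _ hζ2)
        (Real.exp_pos _).le) (Real.exp_pos _).le).trans ?_
      rw [← Real.exp_add, ← Real.exp_add]
      refine Real.exp_le_exp.2 ?_
      have h3 : L * min (t - 2) T ≤ L * T :=
        mul_le_mul_of_nonneg_left (min_le_right _ _) (by linarith)
      have h5 : L ≤ L * T := by nlinarith
      have h6 : T ≤ L * T := by nlinarith
      have h7 : 12 * L * (T / 2) ≤ 12 * L * Real.log (t / 2) :=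
        mul_le_mul_of_nonneg_left h1 (by linarith)
      linarith
    have h3 := (Real.exp_pos (L * (-1 * min (t - 2) T)))
    rw [mul_assoc]
    linarith

/-- A vertex deleted from $V_l$ precedes the $L_\le$-th one in the ordering, whose normalized degree
already exceeds 2. -/
theorem two_le_normDeg_of_lt {d κ : ℝ} (hd : 1 ≤ d) {G : SimpleGraph (Fin N)}
    {σ : Equiv.Perm (Fin N)} (hσ : IsDegreeOrdering d G σ) {l : ℕ}
    (hl : l ≤ lastLarge d κ G σ) {j : Fin N} (hj : (j : ℕ) + 1 < l) : 2 ≤ normDeg d G (σ j) := by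
  set S : Set ℕ :=
    {l : ℕ | ∃ k : Fin N, l = (k : ℕ) + 1 ∧ 2 + Real.log d ^ (-κ) ≤ normDeg d G (σ k)} with hS
  have hne : S.Nonempty := by
    by_contra h
    rw [Set.not_nonempty_iff_eq_empty] at h
    have : lastLarge d κ G σ = 0 := by
      rw [lastLarge, ← hS, h]
      simp
    omega
  have hbdd : BddAbove S := ⟨N, by rintro _ ⟨k, rfl, -⟩; exact k.2⟩
  obtain ⟨k, hk, hk2⟩ := Nat.sSup_mem hne hbdd
  have hlk : l ≤ (k : ℕ) + 1 := by rw [← hk]; exact hl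
  have hjk : j ≤ k := Fin.le_def.2 (by omega)
  have h1 : normDeg d G (σ k) ≤ normDeg d G (σ j) := hσ hjk
  have h2 : 0 ≤ Real.log d ^ (-κ) := Real.rpow_nonneg (Real.log_nonneg hd) _
  linarith

open scoped Classical in
/-- Near a vertex of large degree, eigenvectors of the restricted matrix satisfy the eigenvalue
equation of the pruned graph. -/
theorem eigenvector_equation {P : Measure (SimpleGraph (Fin N))} {d τ κ μ : ℝ} (hd : 1 ≤ d)
    (hτ : τ ≤ 2) {G : SimpleGraph (Fin N)} {σ : Equiv.Perm (Fin N)} (hσ : IsDegreeOrdering d G σ)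
    {l : ℕ} (hl : l ≤ lastLarge d κ G σ) {w : Fin N → ℝ}
    (hw : ∀ y, ∑ z, restrictedMatrix P d τ G σ l y z * w z = μ * w y) {x : Fin N}
    (hx : x ∈ largeDeg d τ G) (hxl : x ∈ vSet σ l) {n : ℕ} (hn : (n : ℝ) + 2 ≤ rVert d τ G x)
    {y : Fin N} (hr : (pruned d τ G).Reachable x y) (hy : (pruned d τ G).dist x y ≤ n) :
    μ * w y = ∑ z ∈ Finset.univ.filter (fun z => (pruned d τ G).Adj y z), w z := by
  have hn0 : (0 : ℝ) ≤ n := Nat.cast_nonneg n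
  -- Deleted vertices have degree at least $2d$, too large for the ball around `x` unless the vertex
  -- is `x`.
  have hmem : ∀ z, (pruned d τ G).Reachable x z → (pruned d τ G).dist x z ≤ n + 1 →
      z ∈ vSet σ l := by
    intro z hz hzn
    by_cases hzx : z = x
    · rw [hzx]; exact hxl
    intro j hj hzj
    have h1 := deg_lt_of_dist_le hx (m := n + 1) (by push_cast; linarith) hz hzx hzn
    have h2 := two_le_normDeg_of_lt hd hσ hl hj
    rw [← hzj, normDeg, le_div_iff₀ (by linarith)] at h2
    nlinarith
  have hyl : y ∈ vSet σ l := hmem y hr (by omega)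
  -- This kills row `y` of $\Pi_\tau(\mathbb EA)\Pi_\tau$, so the neighbours of `y` need not lie in
  -- $\mathcal Z_\tau$.
  have hyz : y ∈ zSet d τ G := ⟨x, hx, hr, by
    have : ((pruned d τ G).dist x y : ℝ) ≤ n := by exact_mod_cast hy
    linarith⟩
  rw [← hw y, Finset.sum_filter]
  refine Finset.sum_congr rfl fun z _ => ?_
  have hcp : centredPruned P d τ G y z = if (pruned d τ G).Adj y z then 1 else 0 := by
    rw [centredPruned, Matrix.sub_apply, projZ, Matrix.mul_diagonal, Matrix.diagonal_mul]
    simp [hyz, adj, adjMatrix_apply]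
  rw [restrictedMatrix, Matrix.of_apply, hcp]
  by_cases hadj : (pruned d τ G).Adj y z
  · have hzl : z ∈ vSet σ l := by
      refine hmem z (hr.trans hadj.reachable) ?_
      have := hr.dist_triangle_left z
      rw [dist_eq_one_iff_adj.2 hadj] at this
      omega
    simp [hadj, hzl, hyl]
  · simp [hadj]

/-- The delocalization estimate holds for every graph in which each vertex has few neighbours of
high degree, and the radii of the balls around vertices of large degree are at least
logarithmic. -/
theorem delocalizationEstimate_of_highNbrs {P : Measure (SimpleGraph (Fin N))}
    {C d θ τ κ : ℝ} {G : SimpleGraph (Fin N)} {k n : ℕ} (hC : 1024 ≤ C) (hd : 1 ≤ Real.log d)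
    (hd0 : 0 < d) (hθ : 0 < θ) (hθ2 : θ ≤ 1 / 2) (hτ : τ ≤ 2)
    (hn : 12 * Real.log d ≤ n) (hk : ∀ y, (highNbrs d (d ^ (-θ / 2) / 4) G y).card ≤ k)
    (hkC : 16 * k ≤ C * d ^ (1 - θ)) (hR : ∀ x ∈ largeDeg d τ G, (n : ℝ) + 2 ≤ rVert d τ G x) :
    DelocalizationEstimate P 1 C d θ τ κ G := by
  classical
  intro σ hσ l _ hl μ ζ hμ hζ hmax hμζ w hwn hev
  have hd1 : 1 ≤ d := by
    by_contra! h
    have := Real.log_nonpos hd0.le h.le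
    linarith
  have hsd : 0 < √d := Real.sqrt_pos.2 hd0
  set t := μ / √d with ht
  have hμt : μ = √d * t := by rw [ht]; field_simp
  have ht2 : 2 < t := by rw [ht, lt_div_iff₀ hsd]; exact hμ
  have htζ : 2 + ζ ≤ t := by rw [ht, le_div_iff₀ hsd]; linarith
  set z := d ^ (-θ / 2) with hz
  have hz0 : 0 < z := Real.rpow_pos_of_pos hd0 _
  have hz1 : z ≤ 1 := Real.rpow_le_one_of_one_le_of_nonpos hd1 (by linarith)
  have hzsq : d * z ^ 2 = d ^ (1 - θ) := by
    rw [hz, ← Real.rpow_natCast, ← Real.rpow_mul hd0.le]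
    nth_rewrite 1 [← Real.rpow_one d]
    rw [← Real.rpow_add hd0]
    congr 1
    push_cast
    ring
  -- The factor $(\mu/(\mu-2\sqrt d))^{1/2}$ is at least 1 and is simply dropped.
  have hCz : C * z ≤ ζ := by
    refine le_trans ?_ ((le_max_left _ _).trans hmax)
    refine mul_le_mul_of_nonneg_right ?_ hz0.le
    refine le_mul_of_one_le_right (by linarith) (Real.one_le_rpow ?_ (by norm_num))
    have h0 : 0 < μ - 2 * √d := by linarith
    rw [le_div_iff₀ h0]
    linarith
  have hζ1 : d ^ (-(t - 2)) ≤ ζ := by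
    refine le_trans (le_of_eq ?_) ((le_max_right _ _).trans hmax)
    rw [neg_one_mul]
  have hzζ : z ≤ ζ := by nlinarith
  have hζ2 : d ^ (-(1 / 4) : ℝ) ≤ ζ :=
    (Real.rpow_le_rpow_of_exponent_le hd1 (by linarith)).trans hzζ
  have hkd : ∀ u : ℝ, C / 2 * z ^ 2 ≤ u ^ 2 → 8 * (k : ℝ) ≤ d * u ^ 2 := by
    intro u hu
    have := mul_le_mul_of_nonneg_left hu hd0.le
    nlinarith
  have hkζ : 8 * (k : ℝ) ≤ d * ζ ^ 2 := by
    refine hkd ζ ?_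
    have h1 : (C * z) ^ 2 ≤ ζ ^ 2 := pow_le_pow_left₀ (by positivity) hCz 2
    have h2 : 0 ≤ C * z ^ 2 * (C - 1 / 2) := by
      have : 0 ≤ C - 1 / 2 := by linarith
      positivity
    nlinarith
  obtain ⟨hη1, hη2⟩ := sqrt_two_mul_sub_two (by linarith) hz0 hz1 ht2
    (show C * z ≤ t - 2 by linarith)
  have heq : ∀ y, ∑ v, restrictedMatrix P d τ G σ l y v * w v = μ * w y := by
    intro y
    have := congrArg (fun u : EuclideanSpace ℝ (Fin N) => u y) hev.apply_eq_smul
    simpa [Matrix.toLpLin_apply, Matrix.mulVec, dotProduct] using this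
  set B : Fin N → Finset (Fin N) := fun x => Finset.univ.filter
    (fun y => (pruned d τ G).Reachable x y ∧ (pruned d τ G).dist x y ≤ n + 1) with hB
  set ε : ℝ := (2 / t) ^ n * (4 * t ^ 2 / ζ ^ 2) with hε
  have hε0 : 0 ≤ ε := by positivity
  have hW : ∀ x ∈ wSet d τ μ ζ G, x ∈ largeDeg d τ G ∧ Lam (max (normDeg d G x) 2) + ζ ≤ t := by
    intro x hx
    obtain ⟨-, h1, h2⟩ := Finset.mem_filter.1 hx
    refine ⟨?_, ?_⟩
    · rw [normDeg, le_div_iff₀ hd0] at h1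
      exact h1
    · rw [ht, le_div_iff₀ hsd]
      linarith
  have hvert : ∀ x ∈ wSet d τ μ ζ G, w x ^ 2 ≤ ε * ∑ y ∈ B x, w y ^ 2 := by
    intro x hx
    obtain ⟨hxτ, hxt⟩ := hW x hx
    have hS : 0 ≤ ∑ y ∈ B x, w y ^ 2 := Finset.sum_nonneg fun _ _ => sq_nonneg _
    by_cases hxl : x ∈ vSet σ l
    · have hRx := hR x hxτ
      obtain ⟨g0, g1, g2, g3⟩ := lam_weight (le_max_right (normDeg d G x) 2)
      have hrs : (n : ℝ) + 2 ≤ rStar G x / 4 := hRx.trans (min_le_left _ _)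
      have hrs' : 4 * n + 8 ≤ rStar G x := by
        have : (4 * n + 8 : ℝ) ≤ rStar G x := by linarith
        exact_mod_cast this
      have hn0 : (0 : ℝ) ≤ n := Nat.cast_nonneg n
      have h1 := vertex_bound (k := k) (n := n) (s := z / 4) (t := t) (ζ := ζ) hd0 hτ hxτ
        (by omega) (by linarith) hk (by positivity) g0 g1 (le_max_right _ _) g2 hζ
        (by rw [g3]; exact hxt) (le_max_left _ _) (by linarith) hkζ ht2 (by linarith)
        (hkd _ hη2) w (fun y hr hy => by
          rw [← hμt]
          exact eigenvector_equation hd1 hτ hσ hl heq hxτ hxl hRx hr hy)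
      refine h1.trans (mul_le_mul_of_nonneg_right ?_ hS)
      have h2 := le_sq_of_lam_le (show Lam (max (normDeg d G x) 2) ≤ t by linarith)
      rw [hε]
      gcongr
    · have h1 := heq x
      simp only [restrictedMatrix, Matrix.of_apply, hxl, false_and, if_false, zero_mul,
        Finset.sum_const_zero] at h1
      have hμ0 : μ ≠ 0 := by
        have : 0 < μ := by linarith
        exact this.ne'
      have h2 : w x = 0 := by
        rcases mul_eq_zero.1 h1.symm with h | h
        · exact absurd h hμ0
        · exact h
      rw [h2, zero_pow two_ne_zero]
      exact mul_nonneg hε0 hS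
  -- A common point would put two vertices of $\mathcal V_\tau$ within distance
  -- $2(n+1)\le2r_{x,\tau}$.
  have hdisj : Set.PairwiseDisjoint (wSet d τ μ ζ G : Set (Fin N)) B := by
    intro x hx x' hx' hne
    rw [Function.onFun, Finset.disjoint_left]
    intro y hy hy'
    obtain ⟨-, h1, h2⟩ := Finset.mem_filter.1 hy
    obtain ⟨-, h3, h4⟩ := Finset.mem_filter.1 hy'
    have hxτ := (hW x hx).1
    have h5 := two_mul_rVert_lt_dist hxτ (hW x' hx').1 hne.symm (h1.trans h3.symm)
    have h6 := hR x hxτ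
    have h7 := h1.dist_triangle_left x'
    rw [dist_comm (u := y)] at h7
    have h8 : ((pruned d τ G).dist x x' : ℝ) ≤ 2 * (n + 1) := by
      have : (pruned d τ G).dist x x' ≤ 2 * (n + 1) := by omega
      exact_mod_cast this
    linarith
  have hsum : ∑ x ∈ wSet d τ μ ζ G, w x ^ 2 ≤ ε := by
    calc ∑ x ∈ wSet d τ μ ζ G, w x ^ 2 ≤ ∑ x ∈ wSet d τ μ ζ G, ε * ∑ y ∈ B x, w y ^ 2 :=
          Finset.sum_le_sum hvert
      _ = ε * ∑ y ∈ (wSet d τ μ ζ G).biUnion B, w y ^ 2 := by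
          rw [← Finset.mul_sum, Finset.sum_biUnion hdisj]
      _ ≤ ε * ∑ y, w y ^ 2 := mul_le_mul_of_nonneg_left
          (Finset.sum_le_sum_of_subset_of_nonneg (Finset.subset_univ _)
            fun _ _ _ => sq_nonneg _) hε0
      _ = ε := by
          rw [← EuclideanSpace.real_norm_sq_eq, hwn]
          ring
  have hα0 : 0 ≤ ∑ x ∈ wSet d τ μ ζ G, w x ^ 2 := Finset.sum_nonneg fun _ _ => sq_nonneg _
  calc alphaFun t * ∑ x ∈ wSet d τ μ ζ G, w x ^ 2
      ≤ t ^ 2 * ∑ x ∈ wSet d τ μ ζ G, w x ^ 2 :=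
        mul_le_mul_of_nonneg_right (alphaFun_le_sq ht2.le) hα0
    _ ≤ t ^ 2 * ε := mul_le_mul_of_nonneg_left hsum (sq_nonneg t)
    _ ≤ 1024 * d ^ (-1 * min (t - 2) (Real.log t)) := decay_bound hd hd0 ht2 hn hζ1 hζ2
    _ ≤ C * d ^ (-1 * min (t - 2) (Real.log t)) :=
        mul_le_mul_of_nonneg_right hC (Real.rpow_nonneg hd0.le _)

end Deterministic

/-! ### Choice of scales and high-probability events. -/

section Asymptotics

theorem sq_div_three_le_bennett {a : ℝ} (ha : 0 ≤ a) (ha1 : a ≤ 1) : a ^ 2 / 3 ≤ bennett a := by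
  have h1 := mul_le_mul_of_nonneg_left (Real.le_log_one_add_of_nonneg ha)
    (show 0 ≤ 1 + a by linarith)
  have h2 : (1 + a) * (2 * a / (a + 2)) - a = a ^ 2 / (a + 2) := by
    field_simp
    ring
  have h3 : a ^ 2 / 3 ≤ a ^ 2 / (a + 2) :=
    div_le_div_of_nonneg_left (sq_nonneg a) (by linarith) (by linarith)
  rw [bennett]
  linarith

/-- Collects what is required of large `d`; the constant 5000 is generous enough for all numerical
constants below. -/
theorem exists_large_degree_threshold (Q : ℝ) : ∃ d₀ : ℝ, ∀ d ≥ d₀,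
    1 ≤ d ∧ 1 ≤ Real.log d ∧ Real.log d ≤ d ^ (1 / 4 : ℝ) ∧ 5000 * Q ≤ d ^ (1 / 4 : ℝ) := by
  refine Filter.eventually_atTop.1 ?_
  have h1 := (isLittleO_log_rpow_atTop (r := 1 / 4) (by norm_num)).bound one_pos
  filter_upwards [h1, Filter.eventually_ge_atTop 1,
    Real.tendsto_log_atTop.eventually_ge_atTop 1,
    (tendsto_rpow_atTop (y := 1 / 4) (by norm_num)).eventually_ge_atTop (5000 * Q)]
    with d h1 h2 h3 h4
  refine ⟨h2, h3, ?_, h4⟩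
  rw [one_mul, Real.norm_of_nonneg (by linarith),
    Real.norm_of_nonneg (Real.rpow_nonneg (by linarith) _)] at h1
  exact h1

/-- The exponent $4/5$ is a lower bound for $4/(5-2\theta)$, so the threshold does not depend on
$\theta$. -/
theorem exists_vertex_threshold (d₀ : ℝ) : ∃ N₀ : ℝ, 1 ≤ N₀ ∧ ∀ N : ℕ, N₀ ≤ N →
    1 ≤ Real.log N ∧ d₀ ≤ Real.log N ^ (4 / 5 : ℝ) := by
  have h : ∀ᶠ x : ℝ in Filter.atTop, 1 ≤ Real.log x ∧ d₀ ≤ Real.log x ^ (4 / 5 : ℝ) :=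
    (Real.tendsto_log_atTop.eventually_ge_atTop 1).and
      (((tendsto_rpow_atTop (y := 4 / 5) (by norm_num)).comp
        Real.tendsto_log_atTop).eventually_ge_atTop d₀)
  obtain ⟨N₀, hN₀⟩ := Filter.eventually_atTop.1 h
  exact ⟨max N₀ 1, le_max_right _ _, fun N hN => hN₀ N ((le_max_left _ _).trans hN)⟩

theorem mul_exp_neg_log {ν : ℝ} (hN : 0 < N) :
    (N : ℝ) * Real.exp (-((ν + 1) * Real.log N)) = (N : ℝ) ^ (-ν) := by
  have hN' : (0 : ℝ) < N := by exact_mod_cast hN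
  rw [Real.rpow_def_of_pos hN']
  nth_rewrite 1 [← Real.exp_log hN']
  rw [← Real.exp_add]
  ring_nf

/-- The balls around vertices of large degree have a radius of at least logarithmic order. -/
theorem le_rVert {d θ τ Q : ℝ} {G : SimpleGraph (Fin N)} {x : Fin N} (hd1 : 1 ≤ d)
    (hL : 1 ≤ Real.log d) (hLu : Real.log d ≤ d ^ (1 / 4 : ℝ)) (hQ : 1 ≤ Q)
    (hQu : 5000 * Q ≤ d ^ (1 / 4 : ℝ)) (hθ : 0 < θ) (hθ2 : θ ≤ 1 / 2)
    (hτ : 1 + d ^ (-θ / 4) ≤ τ) (hτ2 : τ ≤ 2)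
    (hN : d ^ (3 / 4 : ℝ) ≤ 4 * Q * Real.log N)
    (hx : x ∈ largeDeg d τ G) (hxd : (deg G x : ℝ) ≤ d ^ 2) :
    (⌈12 * Real.log d⌉₊ : ℝ) + 2 ≤ rVert d τ G x := by
  have hd0 : 0 < d := by linarith
  set L := Real.log d with hLdef
  have hceil : (⌈12 * L⌉₊ : ℝ) < 12 * L + 1 := Nat.ceil_lt_add_one (by linarith)
  set u := d ^ (1 / 4 : ℝ) with hu
  have hu0 : 0 < u := Real.rpow_pos_of_pos hd0 _
  have hu3 : d ^ (3 / 4 : ℝ) = u ^ 3 := by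
    rw [hu, ← Real.rpow_natCast, ← Real.rpow_mul hd0.le]
    norm_num
  have hu4 : d = u ^ 4 := by
    rw [hu, ← Real.rpow_natCast, ← Real.rpow_mul hd0.le]
    norm_num
  have hLL : L ^ 2 ≤ u ^ 2 := pow_le_pow_left₀ (by linarith) hLu 2
  have hbig : 5000 * Q * L ^ 2 ≤ u ^ 3 := by
    calc 5000 * Q * L ^ 2 ≤ u * u ^ 2 := mul_le_mul hQu hLL (sq_nonneg _) hu0.le
      _ = u ^ 3 := by ring
  have hLL1 : L ≤ L ^ 2 := by nlinarith
  rw [rVert]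
  refine le_min ?_ ?_
  · have hdeg : d ≤ (deg G x : ℝ) := by
      have h1 : τ * d ≤ (deg G x : ℝ) := hx
      have h2 : 0 < d ^ (-θ / 4) := Real.rpow_pos_of_pos hd0 _
      nlinarith
    have hlog1 : 1 ≤ Real.log (deg G x : ℝ) := hL.trans (Real.log_le_log hd0 hdeg)
    have hlog2 : Real.log (deg G x : ℝ) ≤ 2 * L := by
      have := Real.log_le_log (by linarith) hxd
      rw [Real.log_pow] at this
      exact_mod_cast this
    -- Four times $12L+3$, plus one for the floor in $r_x$.
    have h1 : 48 * L + 13 ≤ Real.log N / (3 * Real.log (deg G x : ℝ)) := by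
      rw [le_div_iff₀ (by linarith)]
      have h2 : (48 * L + 13) * (3 * Real.log (deg G x : ℝ)) ≤ (48 * L + 13) * (6 * L) := by
        have : 3 * Real.log (deg G x : ℝ) ≤ 6 * L := by linarith
        exact mul_le_mul_of_nonneg_left this (by linarith)
      have h3 : 5000 * L ^ 2 ≤ 4 * Real.log N := by
        rw [hu3] at hN
        nlinarith
      nlinarith
    have h2 := Nat.lt_floor_add_one (Real.log N / (3 * Real.log (deg G x : ℝ)))
    rw [rStar]
    linarith
  · set a := (τ - 1) / 2 with ha
    have hexp : d ^ (-(1 / 8) : ℝ) ≤ τ - 1 := by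
      have : d ^ (-(1 / 8) : ℝ) ≤ d ^ (-θ / 4) :=
        Real.rpow_le_rpow_of_exponent_le hd1 (by linarith)
      linarith
    have he0 : 0 < d ^ (-(1 / 8) : ℝ) := Real.rpow_pos_of_pos hd0 _
    have hsq : (d ^ (-(1 / 8) : ℝ)) ^ 2 = u⁻¹ := by
      rw [hu, ← Real.rpow_natCast, ← Real.rpow_mul hd0.le, ← Real.rpow_neg hd0.le]
      norm_num
    have ha2 : u⁻¹ / 4 ≤ a ^ 2 := by
      rw [← hsq, ha]
      nlinarith
    have hben := sq_div_three_le_bennett (a := a) (by linarith) (by linarith)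
    have h1 : u⁻¹ / 12 ≤ bennett a := by linarith
    have h2 : u ^ 3 / (24 * L) ≤ d / (2 * L) * bennett a := by
      calc u ^ 3 / (24 * L) = d / (2 * L) * (u⁻¹ / 12) := by
            rw [hu4]; field_simp; norm_num
        _ ≤ _ := mul_le_mul_of_nonneg_left h1 (by positivity)
    -- Twice $12L+3$, plus the 2 subtracted in $r(\tau)$. The bound $u^3/(24L)$ comes from $h(a)\ge
    -- a^2/3$ and $\tau-1\ge d^{-1/8}$, valid since $\theta\le1/2$.
    have h3 : 24 * L + 8 ≤ u ^ 3 / (24 * L) := by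
      rw [le_div_iff₀ (by linarith)]
      nlinarith
    rw [rTau]
    linarith

/-- With high probability, every vertex has few neighbours of high degree. -/
theorem binomialRandom_real_highNbrs_le {d θ Q : ℝ} {p : unitInterval} (hp : (N : ℝ) * p = d)
    (hd1 : 1 ≤ d) (hLu : Real.log d ≤ d ^ (1 / 4 : ℝ)) (hQ : 1 ≤ Q)
    (hQu : 5000 * Q ≤ d ^ (1 / 4 : ℝ)) (hθ : 0 < θ) (hθ2 : θ ≤ 1 / 2)
    (hN : Real.log N ≤ d ^ (5 / 4 - θ / 2)) :
    (binomialRandom (Fin N) p).real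
      {G | ∃ y, ⌈256 * Q * d ^ (1 / 4 + θ / 2)⌉₊ ≤ (highNbrs d (d ^ (-θ / 2) / 4) G y).card} ≤
      N * Real.exp (-(Q * Real.log N)) := by
  have hd0 : 0 < d := by linarith
  set k := ⌈256 * Q * d ^ (1 / 4 + θ / 2)⌉₊ with hk
  have hpow1 : 1 ≤ d ^ (1 / 4 + θ / 2) := Real.one_le_rpow hd1 (by linarith)
  have hk1 : 256 * Q * d ^ (1 / 4 + θ / 2) ≤ k := Nat.le_ceil _
  have hk2 : (k : ℝ) ≤ 257 * Q * d ^ (1 / 4 + θ / 2) := by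
    have := (Nat.ceil_lt_add_one (show 0 ≤ 256 * Q * d ^ (1 / 4 + θ / 2) by positivity)).le
    nlinarith
  have hz0 : 0 < d ^ (-θ / 2) := Real.rpow_pos_of_pos hd0 _
  have hz1 : d ^ (-θ / 2) ≤ 1 := Real.rpow_le_one_of_one_le_of_nonpos hd1 (by linarith)
  have hkd : (k : ℝ) ≤ d ^ (-θ / 2) / 4 * d / 4 := by
    have h1 : d ^ (-θ / 2) * d = d ^ (1 - θ / 2) := by
      nth_rewrite 2 [← Real.rpow_one d]
      rw [← Real.rpow_add hd0]
      ring_nf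
    have h2 : d ^ (1 / 4 : ℝ) * d ^ (1 / 4 + θ / 2) ≤ d ^ (1 - θ / 2) := by
      rw [← Real.rpow_add hd0]
      exact Real.rpow_le_rpow_of_exponent_le hd1 (by linarith)
    have h3 : 5000 * Q * d ^ (1 / 4 + θ / 2) ≤ d ^ (1 / 4 : ℝ) * d ^ (1 / 4 + θ / 2) :=
      mul_le_mul_of_nonneg_right hQu (by linarith)
    nlinarith
  refine (binomialRandom_real_highNbrs p d (d ^ (-θ / 2) / 4) hp (by positivity) (by linarith) k
    hkd).trans (mul_le_mul_of_nonneg_left ?_ (Nat.cast_nonneg N))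
  have hsq : d * (d ^ (-θ / 2) / 4) ^ 2 / 8 = d ^ (1 - θ) / 128 := by
    have h1 : d * (d ^ (-θ / 2)) ^ 2 = d ^ (1 - θ) := by
      rw [← Real.rpow_natCast, ← Real.rpow_mul hd0.le]
      nth_rewrite 1 [← Real.rpow_one d]
      rw [← Real.rpow_add hd0]
      congr 1
      push_cast
      ring
    rw [← h1]
    ring
  -- Half of the exponent $k\,d^{1-\theta}/128$ pays for the entropy factor $d^k$.
  have hlog : 256 * Real.log d ≤ d ^ (1 - θ) := by
    have h1 : d ^ (1 / 4 : ℝ) * d ^ (1 / 4 : ℝ) ≤ d ^ (1 - θ) := by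
      rw [← Real.rpow_add hd0]
      exact Real.rpow_le_rpow_of_exponent_le hd1 (by linarith)
    nlinarith [Real.log_nonneg hd1]
  -- The other half determines `k`: $(1/4+\theta/2)+(1-\theta)=5/4-\theta/2$, the power of `d` that
  -- dominates $\log N$.
  have hkN : Q * Real.log N ≤ k * (d ^ (1 - θ) / 256) := by
    have h1 : d ^ (1 / 4 + θ / 2) * d ^ (1 - θ) = d ^ (5 / 4 - θ / 2) := by
      rw [← Real.rpow_add hd0]
      ring_nf
    have h2 : 0 ≤ d ^ (1 - θ) := Real.rpow_nonneg hd0.le _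
    nlinarith [mul_le_mul_of_nonneg_right hk1 h2]
  have hdk : d ^ k = Real.exp (k * Real.log d) := by
    rw [Real.exp_nat_mul, Real.exp_log hd0]
  rw [hdk, ← Real.exp_add, hsq]
  refine Real.exp_le_exp.2 ?_
  have hk0 : (0 : ℝ) ≤ k := Nat.cast_nonneg k
  nlinarith [mul_le_mul_of_nonneg_left hlog hk0]

theorem binomialRandom_real_exists_deg_ge {d : ℝ} {p : unitInterval} (hp : (N : ℝ) * p = d)
    (a J : ℝ) (ha : 0 ≤ a) :
    (binomialRandom (Fin N) p).real {G | ∃ x, J ≤ (deg G x : ℝ)} ≤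
      N * Real.exp (d * (Real.exp a - 1) - a * J) := by
  have hset : {G : SimpleGraph (Fin N) | ∃ x, J ≤ (deg G x : ℝ)} ⊆
      ⋃ x ∈ (Finset.univ : Finset (Fin N)), {G | J ≤ (deg G x : ℝ)} := by
    rintro G ⟨x, hx⟩
    simpa using ⟨x, hx⟩
  refine (measureReal_mono hset (measure_ne_top _ _)).trans
    ((measureReal_biUnion_finset_le _ _).trans ?_)
  refine (Finset.sum_le_sum fun x _ => binomialRandom_real_deg_ge p x a J ha).trans ?_
  rw [hp]
  simp

/-- With high probability, all degrees are at most `d ^ 2`. -/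
theorem binomialRandom_real_exists_deg_ge_sq {d Q : ℝ} {p : unitInterval} (hp : (N : ℝ) * p = d)
    (hd1 : 1 ≤ d) (hQ : 1 ≤ Q) (hQu : 5000 * Q ≤ d ^ (1 / 4 : ℝ))
    (hN : Real.log N ≤ d ^ (5 / 4 : ℝ)) :
    (binomialRandom (Fin N) p).real {G | ∃ x, d ^ 2 ≤ (deg G x : ℝ)} ≤
      N * Real.exp (-(Q * Real.log N)) := by
  have hd0 : 0 < d := by linarith
  refine (binomialRandom_real_exists_deg_ge hp 1 (d ^ 2) zero_le_one).trans
    (mul_le_mul_of_nonneg_left (Real.exp_le_exp.2 ?_) (Nat.cast_nonneg N))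
  have h4 : Real.exp 1 - 1 ≤ 2 := by have := Real.exp_one_lt_d9; linarith
  have h6 : d ^ (5 / 4 : ℝ) = d * d ^ (1 / 4 : ℝ) := by
    nth_rewrite 2 [← Real.rpow_one d]
    rw [← Real.rpow_add hd0]
    norm_num
  have hu4 : d = (d ^ (1 / 4 : ℝ)) ^ 4 := by
    rw [← Real.rpow_natCast, ← Real.rpow_mul hd0.le]
    norm_num
  rw [h6] at hN
  generalize d ^ (1 / 4 : ℝ) = u at *
  have hu1 : 5000 ≤ u := by linarith
  have h7 : Q * Real.log N ≤ Q * (d * u) := mul_le_mul_of_nonneg_left hN (by linarith)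
  have h8 : Q * u + 2 ≤ d := by
    have h9 : Q * u ≤ u * u := mul_le_mul_of_nonneg_right (by linarith) (by linarith)
    have h10 : 2 ≤ u * u := by nlinarith
    have h11 : u * u * 2 ≤ (u * u) * (u * u) := mul_le_mul_of_nonneg_left h10 (by nlinarith)
    rw [hu4, show u ^ 4 = (u * u) * (u * u) by ring]
    linarith
  have h12 : d * (Real.exp 1 - 1) ≤ d * 2 := mul_le_mul_of_nonneg_left h4 hd0.le
  have h13 : d * (Q * u + 2) ≤ d * d := mul_le_mul_of_nonneg_left h8 hd0.le
  linarith

/-- If `d` is large compared with a power of `log N`, there are no vertices of large degree. -/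
theorem binomialRandom_real_exists_largeDeg {d θ τ Q : ℝ} {p : unitInterval}
    (hp : (N : ℝ) * p = d) (hd1 : 1 ≤ d) (hθ2 : θ ≤ 1 / 2)
    (hτ : 1 + d ^ (-θ / 4) ≤ τ) (hτ2 : τ ≤ 2) (hN : 4 * Q * Real.log N ≤ d ^ (3 / 4 : ℝ)) :
    (binomialRandom (Fin N) p).real {G | ∃ x, τ * d ≤ (deg G x : ℝ)} ≤
      N * Real.exp (-(Q * Real.log N)) := by
  have hd0 : 0 < d := by linarith
  have he0 : 0 < d ^ (-(1 / 8) : ℝ) := Real.rpow_pos_of_pos hd0 _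
  have hexp : d ^ (-(1 / 8) : ℝ) ≤ τ - 1 := by
    have : d ^ (-(1 / 8) : ℝ) ≤ d ^ (-θ / 4) :=
      Real.rpow_le_rpow_of_exponent_le hd1 (by linarith)
    linarith
  have hsq : d * (d ^ (-(1 / 8) : ℝ)) ^ 2 = d ^ (3 / 4 : ℝ) := by
    rw [← Real.rpow_natCast, ← Real.rpow_mul hd0.le]
    nth_rewrite 1 [← Real.rpow_one d]
    rw [← Real.rpow_add hd0]
    norm_num
  -- With tilt $a=(\tau-1)/2$ the exponent is at most $d(a+a^2)-a(1+2a)d=-a^2d\le-d^{3/4}/4$.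
  obtain ⟨a, rfl⟩ : ∃ a, τ = 1 + 2 * a := ⟨(τ - 1) / 2, by ring⟩
  have ha0 : 0 ≤ a := by linarith
  have hexpa : Real.exp a - 1 ≤ a + a ^ 2 := by
    have := Real.abs_exp_sub_one_sub_id_le (x := a) (by rw [abs_le]; constructor <;> linarith)
    have := (abs_le.1 this).2
    linarith
  refine (binomialRandom_real_exists_deg_ge hp a ((1 + 2 * a) * d) ha0).trans
    (mul_le_mul_of_nonneg_left (Real.exp_le_exp.2 ?_) (Nat.cast_nonneg N))
  have h2 : d * (Real.exp a - 1) ≤ d * (a + a ^ 2) := mul_le_mul_of_nonneg_left hexpa hd0.le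
  have h3 : (d ^ (-(1 / 8) : ℝ)) ^ 2 ≤ (2 * a) ^ 2 := pow_le_pow_left₀ he0.le (by linarith) 2
  have h4 := mul_le_mul_of_nonneg_left h3 hd0.le
  nlinarith

/-- The probability bound for the delocalization estimate above the thresholds for `d`. -/
theorem binomialRandom_real_delocalizationEstimate {C d θ τ κ Q δ : ℝ} {p : unitInterval}
    (hp : (N : ℝ) * p = d) (hd1 : 1 ≤ d) (hL : 1 ≤ Real.log d)
    (hLu : Real.log d ≤ d ^ (1 / 4 : ℝ)) (hQ : 1 ≤ Q) (hQu : 5000 * Q ≤ d ^ (1 / 4 : ℝ))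
    (hθ : 0 < θ) (hθ2 : θ ≤ 1 / 2) (hN : Real.log N ≤ d ^ (5 / 4 - θ / 2))
    (hτ : 1 + d ^ (-θ / 4) ≤ τ) (hτ2 : τ ≤ 2) (hC : 5000 * Q ≤ C)
    (hδ : N * Real.exp (-(Q * Real.log N)) = δ) :
    1 - 2 * δ ≤ (binomialRandom (Fin N) p).real
      {G | DelocalizationEstimate (binomialRandom (Fin N) p) 1 C d θ τ κ G} := by
  have hd0 : 0 < d := by linarith
  have hδ0 : 0 ≤ δ := by rw [← hδ]; positivity
  have hcompl : ∀ S T : Set (SimpleGraph (Fin N)), (binomialRandom (Fin N) p).real S ≤ 2 * δ →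
      (∀ G, G ∉ S → G ∈ T) → 1 - 2 * δ ≤ (binomialRandom (Fin N) p).real T := by
    intro S T hS hST
    have h1 : (Set.univ : Set (SimpleGraph (Fin N))) ⊆ S ∪ T := fun G _ =>
      or_iff_not_imp_left.2 (hST G)
    have h2 := (measureReal_mono (μ := binomialRandom (Fin N) p) h1 (measure_ne_top _ _)).trans
      (measureReal_union_le S T)
    rw [probReal_univ] at h2
    linarith
  -- Either `d` is so large that no vertex reaches degree $\tau d$, or $\log N$ is so large that
  -- $r_x$ exceeds a multiple of $\log d$.
  rcases le_or_gt (4 * Q * Real.log N) (d ^ (3 / 4 : ℝ)) with hcase | hcase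
  · refine hcompl {G | ∃ x, τ * d ≤ (deg G x : ℝ)} _ ?_ ?_
    · have := binomialRandom_real_exists_largeDeg hp hd1 hθ2 hτ hτ2 hcase
      linarith
    · intro G hG σ _ l _ _ μ ζ _ _ _ _ w _ _
      have hW : wSet d τ μ ζ G = ∅ := by
        refine Finset.eq_empty_of_forall_notMem fun x hx => hG ⟨x, ?_⟩
        have := (Finset.mem_filter.1 hx).2.1
        rwa [normDeg, le_div_iff₀ hd0] at this
      rw [hW, Finset.sum_empty, mul_zero]
      exact mul_nonneg (by linarith) (Real.rpow_nonneg hd0.le _)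
  · refine hcompl ({G | ∃ y, ⌈256 * Q * d ^ (1 / 4 + θ / 2)⌉₊ ≤
      (highNbrs d (d ^ (-θ / 2) / 4) G y).card} ∪ {G | ∃ x, d ^ 2 ≤ (deg G x : ℝ)}) _ ?_ ?_
    · refine (measureReal_union_le _ _).trans ?_
      have h1 := binomialRandom_real_highNbrs_le hp hd1 hLu hQ hQu hθ hθ2 hN
      have h2 := binomialRandom_real_exists_deg_ge_sq hp hd1 hQ hQu
        (hN.trans (Real.rpow_le_rpow_of_exponent_le hd1 (by linarith)))
      linarith
    · intro G hG
      rw [Set.mem_union, not_or] at hG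
      refine delocalizationEstimate_of_highNbrs (k := ⌈256 * Q * d ^ (1 / 4 + θ / 2)⌉₊)
        (n := ⌈12 * Real.log d⌉₊) (by linarith) hL hd0 hθ hθ2 hτ2 (Nat.le_ceil _)
        (fun y => le_of_not_ge fun h => hG.1 ⟨y, h⟩) ?_ fun x hx =>
          le_rVert hd1 hL hLu hQ hQu hθ hθ2 hτ hτ2 hcase.le hx
            (le_of_not_ge fun h => hG.2 ⟨x, h⟩)
      have hpow1 : 1 ≤ d ^ (1 / 4 + θ / 2) := Real.one_le_rpow hd1 (by linarith)
      have hpow2 : d ^ (1 / 4 + θ / 2) ≤ d ^ (1 - θ) :=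
        -- Here $1/4+\theta/2\le1-\theta$, which is exactly $\theta\le1/2$.
        Real.rpow_le_rpow_of_exponent_le hd1 (by linarith)
      have hk := (Nat.ceil_lt_add_one
        (show 0 ≤ 256 * Q * d ^ (1 / 4 + θ / 2) by positivity)).le
      have h1 : 1 ≤ Q * d ^ (1 / 4 + θ / 2) := one_le_mul_of_one_le_of_one_le hQ hpow1
      calc 16 * (⌈256 * Q * d ^ (1 / 4 + θ / 2)⌉₊ : ℝ)
          ≤ 5000 * Q * d ^ (1 / 4 + θ / 2) := by linarith
        _ ≤ C * d ^ (1 - θ) := mul_le_mul hC hpow2 (by linarith) (by linarith)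

end Asymptotics

end ERGraph

end

theorem proposition7p2 :
    ∃ c : ℝ, 0 < c ∧ ∀ ν : ℝ, 0 < ν → ∃ K : ℝ, 1 ≤ K ∧ ∃ C : ℝ, 0 < C ∧
      ∀ (N : ℕ) (d θ τ κ : ℝ) (p : unitInterval),
        0 < d → d < (N : ℝ) → (p : ℝ) = d / (N : ℝ) →
        0 < κ → κ < 1 / 2 →
        0 < θ → θ ≤ 1 / 2 →
        Real.log (N : ℝ) ^ (4 / (5 - 2 * θ)) ≤ d → d ≤ K⁻¹ * (N : ℝ) ^ (1 / 4 : ℝ) →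
        1 + d ^ (-θ / 4) ≤ τ → τ ≤ 2 →
        1 - C * (N : ℝ) ^ (-ν) ≤
          (SimpleGraph.binomialRandom (Fin N) p).real
            {G | ERGraph.DelocalizationEstimate
              (SimpleGraph.binomialRandom (Fin N) p) c C d θ τ κ G} := by
  refine ⟨1, one_pos, fun ν hν => ⟨1, le_rfl, ?_⟩⟩
  have hQ : 1 ≤ ν + 1 := by linarith
  obtain ⟨d₀, hd₀⟩ := ERGraph.exists_large_degree_threshold (ν + 1)
  obtain ⟨N₀, hN₀1, hN₀⟩ := ERGraph.exists_vertex_threshold d₀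
  -- The entry $N_0^\nu$ makes the claim trivial for $N<N_0$, since then $CN^{-\nu}\ge1$.
  set C := max (5000 * (ν + 1)) (N₀ ^ ν) with hC
  have hC1 : 5000 * (ν + 1) ≤ C := le_max_left _ _
  refine ⟨C, by linarith, ?_⟩
  intro N d θ τ κ p hd0 hdN hp _ _ hθ hθ2 hdlog _ hτ hτ2
  have hN0 : 0 < (N : ℝ) := hd0.trans hdN
  have hNp : (N : ℝ) * p = d := by rw [hp]; field_simp
  set P := SimpleGraph.binomialRandom (Fin N) p with hP
  rcases lt_or_ge (N : ℝ) N₀ with hNN | hNN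
  · have h1 : 1 ≤ C * (N : ℝ) ^ (-ν) := by
      have h2 : (N : ℝ) ^ ν ≤ C :=
        (Real.rpow_le_rpow hN0.le hNN.le hν.le).trans (le_max_right _ _)
      rw [Real.rpow_neg hN0.le, ← div_eq_mul_inv, one_le_div (Real.rpow_pos_of_pos hN0 _)]
      exact h2
    have h2 : 0 ≤ P.real {G | ERGraph.DelocalizationEstimate P 1 C d θ τ κ G} :=
      MeasureTheory.measureReal_nonneg
    linarith
  obtain ⟨hlogN, hdN₀⟩ := hN₀ N hNN
  have hdd₀ : d₀ ≤ d := by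
    refine hdN₀.trans (le_trans (Real.rpow_le_rpow_of_exponent_le hlogN ?_) hdlog)
    rw [div_le_div_iff₀ (by norm_num) (by linarith)]
    linarith
  obtain ⟨hd1, hL, hLu, hQu⟩ := hd₀ d hdd₀
  have hlogd : Real.log N ≤ d ^ (5 / 4 - θ / 2) := by
    have h1 := Real.rpow_le_rpow (Real.rpow_nonneg (by linarith) _) hdlog
      (show 0 ≤ 5 / 4 - θ / 2 by linarith)
    rw [← Real.rpow_mul (by linarith)] at h1
    have h2 : 4 / (5 - 2 * θ) * (5 / 4 - θ / 2) = 1 := by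
      have : 5 - 2 * θ ≠ 0 := by linarith
      field_simp
      ring
    rwa [h2, Real.rpow_one] at h1
  have hνpos : 0 < (N : ℝ) ^ (-ν) := Real.rpow_pos_of_pos hN0 _
  have hmain := ERGraph.binomialRandom_real_delocalizationEstimate (κ := κ) hNp hd1 hL hLu hQ hQu
    hθ hθ2 hlogd hτ hτ2 hC1 (ERGraph.mul_exp_neg_log (ν := ν) (by exact_mod_cast hN0))
  have h2C : 2 * (N : ℝ) ^ (-ν) ≤ C * (N : ℝ) ^ (-ν) :=
    mul_le_mul_of_nonneg_right (by linarith) hνpos.le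
  linarith
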